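/- \textbf{Dyson's Threefold Way (classes A, AI, AII).} Let $V$ be a finite-dimensional Hermitian vector space and let a group $G=G_0\cup G_1$ act on $V$, where the subgroup $G_0$ acts by unitary operators and $G_1=G\setminus G_0$, which is either empty or a coset $TG_0$, acts by antiunitary operators. Let $$Z_{\mathrm U(V)}(G_0)=\{U\in \mathrm U(V): U=gUg^{-1}\ \forall g\in G_0\},$$ $$Z(G)=\{U\in \mathrm U(V): U=g_0Ug_0^{-1}=g_1U^{-1}g_1^{-1}\ \forall g_0\in G_0,\ g_1\in G_1\}$$ (the set $Z(G)$ of $G$-compatible time evolutions). Let $\lambda$ run over the isomorphism classes of irreducible representations of $G_0$ that occur in $V$; there are finitely many. For each $\lambda$ fix a representation space $R_\lambda$ with $G_0$-invariant Hermitian scalar product; such choices exist. Put $E_\lambda=\mathrm{Hom}_{G_0}(R_\lambda,V)$, with the scalar product $\langle\psi,\psi'\rangle=\langle\psi(r),\psi'(r)\rangle/\langle r,r\rangle$ (which is independent of $0\ne r\in R_\lambda$), let $V_\lambda\simeq E_\lambda\otimes R_\lambda$ be the sector spanned by all $\psi(r)$, and let $N=\dim E_\lambda$. Then: 1. $V$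 is the orthogonal sum of the sectors $V_\lambda$, and restriction to the sectors, where $U$ acts as $u_\lambda\otimes\mathrm{Id}$, is an isomorphism of topological groups $Z_{\mathrm U(V)}(G_0)\simeq\prod_\lambda \mathrm U(E_\lambda)$. An orthonormal basis of $E_\lambda$ gives $\mathrm U(E_\lambda)\simeq \mathrm U_N$. Write $F_\lambda\subseteq \mathrm U(E_\lambda)$ for the set of the components $u_\lambda$ of the elements of $Z(G)$. 2. If $G_1=\emptyset$, then restriction is a homeomorphism $Z(G)\simeq\prod_\lambda F_\lambda$. If $G_1=TG_0\neq\emptyset$, then $T$ permutes the sectors by an involution $\lambda\mapsto T\lambda$, $TV_\lambda=V_{T\lambda}$, and restriction is a homeomorphism $Z(G)\simeq\prod_{\lambda\in\Omega}F_\lambda$ for every set $\Omega$ that contains exactly one element of each set $\{\lambda,T\lambda\}$. 3. (Class A) If $G_1=\emptyset$, or if $TV_\lambda\ne V_\lambda$, then $F_\lambda=\mathrm U(E_\lambda)\simeq\mathrm U_N$. 4. (Classes AI, AII) If $TV_\lambda=V_\lambda$, then on $V_\lambda\simeq E_\lambda\otimes R_\lambda$ one has $T=\alpha\otimes\beta$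 with $\alpha,\beta$ antiunitary. For every such $\alpha,\beta$ we have $\alpha^2=\epsilon_\alpha\mathrm{Id}$ with $\epsilon_\alpha\in\{\pm1\}$; if moreover $T^2$ acts on $V$ as a scalar, then $T^2=\epsilon_T\mathrm{Id}$ and $\beta^2=\epsilon_\beta\mathrm{Id}$ with signs satisfying $\epsilon_\alpha=\epsilon_T\epsilon_\beta$. With $\tau(u)=\alpha u\alpha^{-1}$ and $K=\{k\in \mathrm U(E_\lambda):\tau(k)=k\}$, $$F_\lambda=\{x\in \mathrm U(E_\lambda):\tau(x)=x^{-1}\},$$ and the Cartan embedding $uK\mapsto u\,\tau(u^{-1})$ is an analytic diffeomorphism $\mathrm U(E_\lambda)/K\to F_\lambda$. A suitable orthonormal basis of $E_\lambda$ identifies $\mathrm U(E_\lambda)$ with $\mathrm U_N$, carrying $K$ to $\mathrm O_N$ and $\mathrm U(E_\lambda)/K$ to $\mathrm U_N/\mathrm O_N$ if $\epsilon_\alpha=+1$ (class AI); if $\epsilon_\alpha=-1$ then $N$ is even and such a basis carries $K$ to $\mathrm{USp}_N$ and $\mathrm U(E_\lambda)/K$ to $\mathrm U_N/\mathrm{USp}_N$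 (class AII). -/

import Mathlib

open scoped InnerProductSpace

/-! ### Hermitian vector spaces and their unitary groups -/

instance (priority := low) completeSpace_of_finiteDimensional_complex {V : Type*}
    [NormedAddCommGroup V] [InnerProductSpace ℂ V] [FiniteDimensional ℂ V] : CompleteSpace V :=
  FiniteDimensional.complete ℂ V

/-- The unitary group `U(V)` of a finite-dimensional Hermitian space, with the topology
inherited from the algebra of endomorphisms. -/
noncomputable abbrev UGroup (V : Type*) [NormedAddCommGroup V] [InnerProductSpace ℂ V]
    [FiniteDimensional ℂ V] : Submonoid (V →L[ℂ] V) :=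
  unitary (V →L[ℂ] V)

/-- `f` is complex linear and preserves the Hermitian scalar product. -/
structure IsUnitaryOp {V : Type*} [NormedAddCommGroup V] [InnerProductSpace ℂ V]
    (f : AddMonoid.End V) : Prop where
  map_smul : ∀ (z : ℂ) (v : V), f (z • v) = z • f v
  inner_map : ∀ v w : V, ⟪f v, f w⟫_ℂ = ⟪v, w⟫_ℂ

/-- `f` is complex antilinear and preserves the Hermitian scalar product up to conjugation. -/
structure IsAntiunitaryOp {V : Type*} [NormedAddCommGroup V] [InnerProductSpace ℂ V]
    (f : AddMonoid.End V) : Prop where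
  map_smul : ∀ (z : ℂ) (v : V), f (z • v) = (starRingEnd ℂ) z • f v
  inner_map : ∀ v w : V, ⟪f v, f w⟫_ℂ = (starRingEnd ℂ) ⟪v, w⟫_ℂ

/-! ### The symmetry group `G = G₀ ∪ T G₀` and compatible time evolutions -/

/-- An action of a group `G` on a Hermitian space `V` by unitary operators (the elements of the
subgroup `G₀`) and antiunitary operators (the elements of `G₁ = G \ G₀`). The set `G₁` is either
empty or a single coset `T G₀`. -/
structure SymmetryAction (G : Type*) [Group G] (V : Type*) [NormedAddCommGroup V]
    [InnerProductSpace ℂ V] where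
  G₀ : Subgroup G
  ρ : G →* AddMonoid.End V
  unitary_of_mem : ∀ g ∈ G₀, IsUnitaryOp (ρ g)
  antiunitary_of_notMem : ∀ g ∉ G₀, IsAntiunitaryOp (ρ g)
  mem_coset : ∀ T ∉ G₀, ∀ g ∉ G₀, ∃ h ∈ G₀, g = T * h

namespace SymmetryAction

variable {G : Type*} [Group G] {V : Type*} [NormedAddCommGroup V] [InnerProductSpace ℂ V]

/-- `V` as a complex representation of `G₀`. -/
def rep (S : SymmetryAction G V) : Representation ℂ S.G₀ V where
  toFun g :=
    { toFun := S.ρ g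
      map_add' := map_add (S.ρ g)
      map_smul' := (S.unitary_of_mem g g.2).map_smul }
  map_one' := by ext v; simp
  map_mul' g h := by ext v; simp

variable [FiniteDimensional ℂ V]

/-- The group `Z_{U(V)}(G₀)` of `G₀`-compatible time evolutions. -/
def unitaryCentralizer (S : SymmetryAction G V) : Subgroup (UGroup V) where
  carrier := {U | ∀ g ∈ S.G₀, ∀ v, (U : V →L[ℂ] V) v
    = S.ρ g ((U : V →L[ℂ] V) (S.ρ g⁻¹ v))}
  one_mem' := by
    intro g _ v
    have h : (S.ρ g * S.ρ g⁻¹) v = v := by rw [← map_mul]; simp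
    simpa using h.symm
  mul_mem' := by
    intro U W hU hW g hg v
    have h : ∀ w, S.ρ g⁻¹ (S.ρ g w) = w := fun w => by
      change (S.ρ _ * S.ρ _) w = w; rw [← map_mul]; simp
    simp only [Submonoid.coe_mul, mul_apply_eq_comp]
    rw [hW g hg v, hU g hg, h]
  inv_mem' := by
    intro U hU g hg v
    have h1 : ∀ w, (U : V →L[ℂ] V) (((U⁻¹ : UGroup V) : V →L[ℂ] V) w) = w := fun w => by
      rw [← mul_apply_eq_comp, ← Submonoid.coe_mul]; simp
    have h2 : ∀ w, ((U⁻¹ : UGroup V) : V →L[ℂ] V) ((U : V →L[ℂ] V) w) = w := fun w => by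
      rw [← mul_apply_eq_comp, ← Submonoid.coe_mul]; simp
    have h3 : ∀ w, S.ρ g⁻¹ (S.ρ g w) = w := fun w => by
      change (S.ρ _ * S.ρ _) w = w; rw [← map_mul]; simp
    have h4 : ∀ w, S.ρ g (S.ρ g⁻¹ w) = w := fun w => by
      change (S.ρ _ * S.ρ _) w = w; rw [← map_mul]; simp
    conv_lhs => rw [← h4 v, ← h1 (S.ρ g⁻¹ v)]
    have h5 := hU g hg (S.ρ g (((U⁻¹ : UGroup V) : V →L[ℂ] V) (S.ρ g⁻¹ v)))
    rw [h3] at h5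
    rw [← h5, h2]

/-- The set `Z_{U(V)}(G)` of `G`-compatible time evolutions: the `U ∈ U(V)` with
`U = g₀ U g₀⁻¹ = g₁ U⁻¹ g₁⁻¹` for all `g₀ ∈ G₀` and `g₁ ∈ G₁`. -/
def compatible (S : SymmetryAction G V) : Set (UGroup V) :=
  {U | (∀ g ∈ S.G₀, ∀ v, (U : V →L[ℂ] V) v = S.ρ g ((U : V →L[ℂ] V) (S.ρ g⁻¹ v))) ∧
    (∀ g ∉ S.G₀, ∀ v, (U : V →L[ℂ] V) v
      = S.ρ g (((U⁻¹ : UGroup V) : V →L[ℂ] V) (S.ρ g⁻¹ v)))}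

end SymmetryAction

/-! ### The Hermitian structure of `Hom_{G₀}(R, V)` -/

section HomSpace

open Representation

variable {H : Type*} [Group H] {R V : Type*} [NormedAddCommGroup R] [InnerProductSpace ℂ R]
  [NormedAddCommGroup V] [InnerProductSpace ℂ V]
  {σ : Representation ℂ H R} {ρ : Representation ℂ H V}

theorem exists_ne_zero_of_isIrreducible (σ : Representation ℂ H R) [IsIrreducible σ] :
    ∃ r : R, r ≠ 0 := by
  by_contra! h
  apply (bot_ne_top : (⊥ : Subrepresentation σ) ≠ ⊤)
  apply Subrepresentation.toSubmodule_injective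
  refine le_antisymm bot_le ?_
  intro x _
  rw [h x]
  exact Submodule.zero_mem _

/-- A nonzero reference vector of an irreducible representation space. -/
noncomputable def refVec (σ : Representation ℂ H R) [IsIrreducible σ] : R :=
  (exists_ne_zero_of_isIrreducible σ).choose

theorem refVec_ne_zero (σ : Representation ℂ H R) [IsIrreducible σ] : refVec σ ≠ 0 :=
  (exists_ne_zero_of_isIrreducible σ).choose_spec

theorem intertwiningMap_eq_zero_of_refVec [IsIrreducible σ] (ψ : IntertwiningMap σ ρ)
    (h : ψ (refVec σ) = 0) : ψ = 0 := by
  rcases IsIrreducible.injective_or_eq_zero ψ with hi | h0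
  · exact absurd (hi (h.trans (map_zero ψ).symm)) (refVec_ne_zero σ)
  · exact h0

/-- The scalar product `⟨ψ, ψ'⟩ = ⟨ψ r, ψ' r⟩ / ⟨r, r⟩` on `Hom_{G₀}(R, V)`, for a fixed `r ≠ 0`.
(When the actions are unitary it does not depend on `r`.) -/
@[reducible]
noncomputable def homCore [IsIrreducible σ] :
    InnerProductSpace.Core ℂ (IntertwiningMap σ ρ) where
  inner ψ ψ' := ⟪ψ (refVec σ), ψ' (refVec σ)⟫_ℂ / ⟪refVec σ, refVec σ⟫_ℂ
  conj_inner_symm ψ ψ' := by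
    simp only [map_div₀, inner_conj_symm]
  re_inner_nonneg ψ := by
    rw [inner_self_eq_norm_sq_to_K, inner_self_eq_norm_sq_to_K]
    norm_cast
    positivity
  add_left ψ φ χ := by
    simp [add_div]
  smul_left ψ φ z := by
    simp
    ring
  definite ψ h := by
    apply intertwiningMap_eq_zero_of_refVec
    have h2 : ⟪refVec σ, refVec σ⟫_ℂ ≠ 0 := inner_self_ne_zero.2 (refVec_ne_zero σ)
    exact inner_self_eq_zero.1 ((div_eq_zero_iff.1 h).resolve_right h2)

noncomputable instance homNormedAddCommGroup [IsIrreducible σ] :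
    NormedAddCommGroup (IntertwiningMap σ ρ) :=
  InnerProductSpace.Core.toNormedAddCommGroup (𝕜 := ℂ) (cd := homCore)

noncomputable instance homInnerProductSpace [IsIrreducible σ] :
    InnerProductSpace ℂ (IntertwiningMap σ ρ) :=
  InnerProductSpace.ofCore homCore.toCore

instance homFiniteDimensional [FiniteDimensional ℂ V] [IsIrreducible σ] :
    FiniteDimensional ℂ (IntertwiningMap σ ρ) := by
  let ev : IntertwiningMap σ ρ →ₗ[ℂ] V :=
    { toFun := fun ψ => ψ (refVec σ), map_add' := fun _ _ => rfl, map_smul' := fun _ _ => rfl }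
  refine FiniteDimensional.of_injective ev ?_
  rw [← LinearMap.ker_eq_bot, LinearMap.ker_eq_bot']
  exact fun ψ h => intertwiningMap_eq_zero_of_refVec ψ h

end HomSpace

/-! ### Sectors -/

/-- A choice of a standard representation space `R l`, with an invariant Hermitian scalar product,
for each isomorphism class `l` of irreducible representations of `G₀` that occurs in `V`. -/
structure SectorSystem {G : Type*} [Group G] {V : Type*} [NormedAddCommGroup V]
    [InnerProductSpace ℂ V] (S : SymmetryAction G V) (Λ : Type*) (R : Λ → Type*)
    [∀ l, NormedAddCommGroup (R l)] [∀ l, InnerProductSpace ℂ (R l)] where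
  σ : ∀ l, Representation ℂ S.G₀ (R l)
  unitary : ∀ l g (r r' : R l), ⟪σ l g r, σ l g r'⟫_ℂ = ⟪r, r'⟫_ℂ
  irreducible : ∀ l, (σ l).IsIrreducible
  inequivalent : ∀ l m, Nonempty ((σ l).Equiv (σ m)) → l = m
  occurs : ∀ l, ∃ ψ : (σ l).IntertwiningMap S.rep, ψ ≠ 0
  complete : ∀ W : Subrepresentation S.rep, W.toRepresentation.IsIrreducible →
    ∃ l, Nonempty ((σ l).Equiv W.toRepresentation)

namespace SectorSystem

variable {G : Type*} [Group G] {V : Type*} [NormedAddCommGroup V] [InnerProductSpace ℂ V]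
  {S : SymmetryAction G V} {Λ : Type*} {R : Λ → Type*}
  [∀ l, NormedAddCommGroup (R l)] [∀ l, InnerProductSpace ℂ (R l)]

instance (𝓡 : SectorSystem S Λ R) (l : Λ) : (𝓡.σ l).IsIrreducible := 𝓡.irreducible l

/-- The multiplicity space `E l = Hom_{G₀}(R l, V)`. -/
abbrev E (𝓡 : SectorSystem S Λ R) (l : Λ) : Type _ := (𝓡.σ l).IntertwiningMap S.rep

/-- The sector `V l ⊆ V`, the image of `E l ⊗ R l` under `ψ ⊗ r ↦ ψ r`. -/
def sector (𝓡 : SectorSystem S Λ R) (l : Λ) : Submodule ℂ V :=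
  ⨆ ψ : 𝓡.E l, LinearMap.range ψ.toLinearMap

variable [FiniteDimensional ℂ V]

/-- On the sector `V l ≃ E l ⊗ R l` the operator `U` acts as `x ⊗ 1`. -/
def ActsAs (𝓡 : SectorSystem S Λ R) {l : Λ} (U : UGroup V) (x : UGroup (𝓡.E l)) : Prop :=
  ∀ (ψ : 𝓡.E l) (r : R l), ((x : 𝓡.E l →L[ℂ] 𝓡.E l) ψ) r = (U : V →L[ℂ] V) (ψ r)

/-- The restrictions to the sector `V l` of the `G`-compatible time evolutions, as a subset of
`U(E l)`. -/
def factor (𝓡 : SectorSystem S Λ R) (l : Λ) : Set (UGroup (𝓡.E l)) :=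
  {x | ∃ U ∈ S.compatible, 𝓡.ActsAs U x}

/-- Restriction to the sectors in `Ω` is a homeomorphism from the set of `G`-compatible time
evolutions onto the product of the factors belonging to the sectors in `Ω`. -/
def IsProductOfFactors (𝓡 : SectorSystem S Λ R) (Ω : Set Λ) : Prop :=
  ∃ Φ : S.compatible ≃ₜ (∀ l : Ω, 𝓡.factor l),
    ∀ (U : S.compatible) (l : Ω), 𝓡.ActsAs (U : UGroup V) (Φ U l : UGroup (𝓡.E l))

/-- Under `V l ≃ E l ⊗ R l` the operator `T` is the pure tensor `α ⊗ β`. -/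
def IsTransfer (𝓡 : SectorSystem S Λ R) (T : G) {l : Λ} (α : 𝓡.E l ≃ₗᵢ⋆[ℂ] 𝓡.E l)
    (β : R l ≃ₗᵢ⋆[ℂ] R l) : Prop :=
  ∀ (ψ : 𝓡.E l) (r : R l), S.ρ T (ψ r) = (α ψ) (β r)

end SectorSystem

/-! ### The involution `τ`, the coset space `U/K` and the Cartan embedding -/

section Cartan

variable {E : Type*} [NormedAddCommGroup E] [InnerProductSpace ℂ E] [FiniteDimensional ℂ E]

/-- Conjugation `u ↦ α u α⁻¹` by an antiunitary operator, on isometries. -/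
def conjIsometry (α : E ≃ₗᵢ⋆[ℂ] E) : (E ≃ₗᵢ[ℂ] E) ≃* (E ≃ₗᵢ[ℂ] E) where
  toFun u := (α.symm.trans u).trans α
  invFun u := (α.trans u).trans α.symm
  left_inv u := by ext v; simp
  right_inv u := by ext v; simp
  map_mul' u w := by ext v; simp

/-- The automorphism `τ(u) = α u α⁻¹` of `U(E)`. -/
noncomputable def tau (α : E ≃ₗᵢ⋆[ℂ] E) : UGroup E ≃* UGroup E :=
  (Unitary.linearIsometryEquiv.trans (conjIsometry α)).trans Unitary.linearIsometryEquiv.symm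

theorem tau_apply (α : E ≃ₗᵢ⋆[ℂ] E) (u : UGroup E) (e : E) :
    (tau α u : E →L[ℂ] E) e = α ((u : E →L[ℂ] E) (α.symm e)) := rfl

/-- The subgroup `K` of `τ`-fixed elements. -/
def fixedSubgroup (τ : UGroup E ≃* UGroup E) : Subgroup (UGroup E) where
  carrier := {k | τ k = k}
  one_mem' := map_one τ
  mul_mem' := fun {a b} (ha : τ a = a) (hb : τ b = b) => by
    change τ (a * b) = a * b
    rw [map_mul, ha, hb]
  inv_mem' := fun {a} (ha : τ a = a) => by
    change τ a⁻¹ = a⁻¹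
    rw [map_inv, ha]

/-- The set `{x ∈ U(E) | τ(x) = x⁻¹}`. -/
def cartanSet (τ : UGroup E ≃* UGroup E) : Set (UGroup E) := {x | τ x = x⁻¹}

/-- Given an embedding `ι` of `X` in a real normed space `A`, the function `f` on `X` is
real-analytic at `x` if near `x` it is the restriction of a function that is real-analytic at `ι x`
on `A`. -/
def AnalyticVia {A X : Type*} [NormedAddCommGroup A] [NormedSpace ℝ A] [TopologicalSpace X]
    (ι : X → A) (f : X → ℝ) (x : X) : Prop :=
  ∃ g : A → ℝ, AnalyticAt ℝ g (ι x) ∧ ∀ᶠ y in nhds x, f y = g (ι y)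

/-- The map `u K ↦ u τ(u⁻¹)` is well defined and is an analytic diffeomorphism from `U/K` onto
`{x ∈ U | τ(x) = x⁻¹}`: it is a homeomorphism that identifies the (germs of) real-analytic
functions on both sides. As usual, a function on `U/K` is analytic iff its pull-back to `U` is. -/
def IsCartanEmbedding (τ : UGroup E ≃* UGroup E) : Prop :=
  ∃ F : (UGroup E ⧸ fixedSubgroup τ) ≃ₜ cartanSet τ,
    (∀ u : UGroup E, (F (u : UGroup E ⧸ fixedSubgroup τ) : UGroup E) = u * τ u⁻¹) ∧
    ∀ (f : cartanSet τ → ℝ) (u : UGroup E),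
      AnalyticVia (fun x : cartanSet τ => ((x : UGroup E) : E →L[ℂ] E)) f
          (F (u : UGroup E ⧸ fixedSubgroup τ)) ↔
        AnalyticVia (fun w : UGroup E => (w : E →L[ℂ] E))
          (fun w => f (F (w : UGroup E ⧸ fixedSubgroup τ))) u

/-! ### Comparison with the classical matrix groups -/

/-- `c` is the isomorphism `U(E) ≃ U_N` that sends a unitary operator to its matrix in some
orthonormal basis. -/
def IsMatrixIso {ι : Type*} [Fintype ι] [DecidableEq ι]
    (c : UGroup E ≃ₜ* Matrix.unitaryGroup ι ℂ) : Prop :=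
  ∃ b : OrthonormalBasis ι ℂ E, ∀ (u : UGroup E) (i j : ι),
    (c u : Matrix ι ι ℂ) i j = ⟪b i, (u : E →L[ℂ] E) (b j)⟫_ℂ

/-- The choice of an orthonormal basis of `E` identifies `U(E)` with `U_N`, the subgroup `K` with
`L`, and the coset space `U(E)/K` with `U_N/L`. -/
def IsCosetModel (K : Subgroup (UGroup E)) {ι : Type*} [Fintype ι] [DecidableEq ι]
    (L : Subgroup (Matrix.unitaryGroup ι ℂ)) : Prop :=
  ∃ c : UGroup E ≃ₜ* Matrix.unitaryGroup ι ℂ, IsMatrixIso c ∧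
    (∀ u : UGroup E, u ∈ K ↔ c u ∈ L) ∧
    ∃ h : (UGroup E ⧸ K) ≃ₜ (Matrix.unitaryGroup ι ℂ ⧸ L),
      ∀ u : UGroup E, h (u : UGroup E ⧸ K) = ((c u : Matrix.unitaryGroup ι ℂ) :
        Matrix.unitaryGroup ι ℂ ⧸ L)

end Cartan

/-- The real orthogonal group `O_N` as a subgroup of `U_N`. -/
def orthogonalSubgroup (ι : Type*) [Fintype ι] [DecidableEq ι] :
    Subgroup (Matrix.unitaryGroup ι ℂ) where
  carrier := {u | ∃ o ∈ Matrix.orthogonalGroup ι ℝ,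
    (u : Matrix ι ι ℂ) = o.map (fun t : ℝ => (t : ℂ))}
  one_mem' := ⟨1, one_mem _, by ext i j; by_cases h : i = j <;> simp [h]⟩
  mul_mem' := by
    rintro a b ⟨o, ho, ha⟩ ⟨p, hp, hb⟩
    refine ⟨o * p, mul_mem ho hp, ?_⟩
    rw [Submonoid.coe_mul, ha, hb]
    ext i j
    simp [Matrix.mul_apply]
  inv_mem' := by
    rintro a ⟨o, ho, ha⟩
    refine ⟨star o, Unitary.star_mem ho, ?_⟩
    rw [← Unitary.star_eq_inv, Unitary.coe_star, ha]
    ext i j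
    simp [Matrix.star_apply]

/-- The unitary symplectic group `USp_{2n}` as a subgroup of `U_{2n}`. -/
def unitarySymplecticSubgroup (ι : Type*) [Fintype ι] [DecidableEq ι] :
    Subgroup (Matrix.unitaryGroup (ι ⊕ ι) ℂ) where
  carrier := {u | (u : Matrix (ι ⊕ ι) (ι ⊕ ι) ℂ) ∈ Matrix.symplecticGroup ι ℂ}
  one_mem' := one_mem (Matrix.symplecticGroup ι ℂ)
  mul_mem' := fun {a b} ha hb => by
    change ((a * b : Matrix.unitaryGroup (ι ⊕ ι) ℂ) : Matrix (ι ⊕ ι) (ι ⊕ ι) ℂ) ∈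
      Matrix.symplecticGroup ι ℂ
    rw [Submonoid.coe_mul]
    exact (Matrix.symplecticGroup ι ℂ).mul_mem ha hb
  inv_mem' := by
    intro a ha
    have h1 : ((⟨_, ha⟩⁻¹ : Matrix.symplecticGroup ι ℂ) : Matrix (ι ⊕ ι) (ι ⊕ ι) ℂ) * a = 1 :=
      congrArg Subtype.val (inv_mul_cancel (⟨_, ha⟩ : Matrix.symplecticGroup ι ℂ))
    have h2 : (a : Matrix (ι ⊕ ι) (ι ⊕ ι) ℂ) * ((a⁻¹ : Matrix.unitaryGroup (ι ⊕ ι) ℂ) :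
        Matrix (ι ⊕ ι) (ι ⊕ ι) ℂ) = 1 := by
      rw [← Submonoid.coe_mul]; simp
    have h3 := left_inv_eq_right_inv h1 h2
    change ((a⁻¹ : Matrix.unitaryGroup (ι ⊕ ι) ℂ) : Matrix (ι ⊕ ι) (ι ⊕ ι) ℂ) ∈
      Matrix.symplecticGroup ι ℂ
    rw [← h3]
    exact Subtype.property _

/-! ### Schur's lemma for unitary representations -/

section Schur

open Representation

variable {H : Type*} [Group H] {R R' V : Type*} [NormedAddCommGroup R] [InnerProductSpace ℂ R]
  [NormedAddCommGroup R'] [InnerProductSpace ℂ R']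
  [NormedAddCommGroup V] [InnerProductSpace ℂ V]
  {σ : Representation ℂ H R} {σ' : Representation ℂ H R'} {ρ : Representation ℂ H V}

/-! Everything rests on one consequence of Schur's lemma. For intertwiners `ψ`, `ψ'` from
irreducible unitary spaces into `V`, the map `ψ'* ψ` is again an intertwiner: it vanishes between
inequivalent spaces and is a scalar on a single one. Hence `⟪ψ r, ψ' r'⟫ = ⟪ψ, ψ'⟫ * ⟪r, r'⟫` within
a sector (`inner_apply_apply`), and distinct sectors are orthogonal. This formula stands in for the
isometry of `E ⊗ R` with the sector, so no tensor product is formed. It lets unitaries pass from `V`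
to the spaces `E l` (`exists_actsAs`) and be glued back (`exists_mem_unitaryCentralizer`).

An antiunitary `T` carries the irreducible subspace `ψ(R l)` onto some `χ(R m)`. Comparing the two
gives `β = χ⁻¹ T ψ` and then `α φ = T φ β⁻¹`, so that `T = α ⊗ β` (`exists_transfer`). Since `T² ∈
G₀`, the induced map of sectors is an involution. Compatibility amounts to commuting with `G₀`
together with `U T U = T`. On two exchanged sectors this equation lets one component be arbitrary
and determines the other; on a fixed sector it becomes `x α x = α`, that is `τ(x) = x⁻¹`. There `α²
⊗ β² = 1 ⊗ σ(T²)` forces `α²` to be a scalar, and antilinearity makes it `±1`.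

The Cartan map is onto because `τ(x) = x⁻¹` says that `x α` is an antiunitary with the same square
as `α`. Such operators have a common normal form (a basis of fixed vectors, or of pairs `v, α v`),
so `x α = u α u⁻¹` for some unitary `u`, and `x = u τ(u⁻¹)`. The same normal forms identify `K` with
`O_N` or `USp_N`. Analyticity of the inverse comes from a local section built from the square root
near the identity (`exists_analytic_section`). Inverses are continuous because unitary groups are
compact. -/

theorem Representation.inner_apply_left (hρ : ∀ g v w, ⟪ρ g v, ρ g w⟫_ℂ = ⟪v, w⟫_ℂ)
    (g : H) (v w : V) : ⟪ρ g v, w⟫_ℂ = ⟪v, ρ g⁻¹ w⟫_ℂ := by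
  rw [← hρ g v, Representation.self_inv_apply]

theorem finiteDimensional_of_intertwiningMap_ne_zero [FiniteDimensional ℂ V] [IsIrreducible σ]
    {ψ : IntertwiningMap σ ρ} (h : ψ ≠ 0) : FiniteDimensional ℂ R :=
  FiniteDimensional.of_injective ψ.toLinearMap
    ((IsIrreducible.injective_or_eq_zero ψ).resolve_right h)

/-- The intertwining operator `ψ'* ψ`. -/
noncomputable def adjointComp [FiniteDimensional ℂ V] [FiniteDimensional ℂ R']
    (hσ' : ∀ g v w, ⟪σ' g v, σ' g w⟫_ℂ = ⟪v, w⟫_ℂ)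
    (hρ : ∀ g v w, ⟪ρ g v, ρ g w⟫_ℂ = ⟪v, w⟫_ℂ)
    (ψ' : IntertwiningMap σ' ρ) (ψ : IntertwiningMap σ ρ) : IntertwiningMap σ σ' where
  toLinearMap := LinearMap.adjoint ψ'.toLinearMap ∘ₗ ψ.toLinearMap
  isIntertwining' g := by
    ext r
    refine ext_inner_left ℂ fun s => ?_
    simp only [LinearMap.comp_apply, LinearMap.adjoint_inner_right,
      IntertwiningMap.toLinearMap_apply, ψ.isIntertwining]
    have h1 := Representation.inner_apply_left hρ g⁻¹ (ψ' s) (ψ r)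
    have h2 := Representation.inner_apply_left hσ' g⁻¹ s (LinearMap.adjoint ψ'.toLinearMap (ψ r))
    rw [inv_inv] at h1 h2
    rw [← h1, ← h2, LinearMap.adjoint_inner_right, IntertwiningMap.toLinearMap_apply,
      ψ'.isIntertwining]

theorem inner_adjointComp [FiniteDimensional ℂ V] [FiniteDimensional ℂ R']
    (hσ' : ∀ g v w, ⟪σ' g v, σ' g w⟫_ℂ = ⟪v, w⟫_ℂ)
    (hρ : ∀ g v w, ⟪ρ g v, ρ g w⟫_ℂ = ⟪v, w⟫_ℂ)
    (ψ' : IntertwiningMap σ' ρ) (ψ : IntertwiningMap σ ρ) (r' : R') (r : R) :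
    ⟪r', adjointComp hσ' hρ ψ' ψ r⟫_ℂ = ⟪ψ' r', ψ r⟫_ℂ :=
  LinearMap.adjoint_inner_right ψ'.toLinearMap r' (ψ r)

/-- Schur's lemma annihilates `ψ'* ψ`. A nonzero `ψ'` embeds `R'` in `V`, which supplies the finite
dimension needed for the adjoint. -/
theorem inner_eq_zero_of_isEmpty_equiv [FiniteDimensional ℂ V] [IsIrreducible σ]
    [IsIrreducible σ'] (hσ' : ∀ g v w, ⟪σ' g v, σ' g w⟫_ℂ = ⟪v, w⟫_ℂ)
    (hρ : ∀ g v w, ⟪ρ g v, ρ g w⟫_ℂ = ⟪v, w⟫_ℂ) (h : IsEmpty (σ.Equiv σ'))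
    (ψ' : IntertwiningMap σ' ρ) (ψ : IntertwiningMap σ ρ) (r' : R') (r : R) :
    ⟪ψ' r', ψ r⟫_ℂ = 0 := by
  by_cases h0 : ψ' = 0
  · simp [h0]
  have := finiteDimensional_of_intertwiningMap_ne_zero h0
  rw [← inner_adjointComp hσ' hρ, Subsingleton.elim (adjointComp hσ' hρ ψ' ψ) 0]
  simp

/-- Over `ℂ` the endomorphism `ψ* ψ'` is a scalar, and evaluation at `refVec σ` identifies it.
Independence of the reference vector follows as well. -/
theorem inner_intertwiningMap_apply [FiniteDimensional ℂ V] [IsIrreducible σ]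
    (hσ : ∀ g v w, ⟪σ g v, σ g w⟫_ℂ = ⟪v, w⟫_ℂ)
    (hρ : ∀ g v w, ⟪ρ g v, ρ g w⟫_ℂ = ⟪v, w⟫_ℂ)
    (ψ ψ' : IntertwiningMap σ ρ) (r r' : R) :
    ⟪ψ r, ψ' r'⟫_ℂ = ⟪ψ, ψ'⟫_ℂ * ⟪r, r'⟫_ℂ := by
  by_cases h0 : ψ = 0
  · simp [h0]
  have := finiteDimensional_of_intertwiningMap_ne_zero h0
  obtain ⟨c, hc⟩ := IsIrreducible.algebraMap_intertwiningMap_bijective_of_isAlgClosed.2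
    (adjointComp hσ hρ ψ ψ')
  have key : ∀ s s' : R, ⟪ψ s, ψ' s'⟫_ℂ = c * ⟪s, s'⟫_ℂ := fun s s' => by
    rw [← inner_adjointComp hσ hρ, ← hc]
    simp
  have h1 : ⟪ψ, ψ'⟫_ℂ = c := by
    change ⟪ψ (refVec σ), ψ' (refVec σ)⟫_ℂ / ⟪refVec σ, refVec σ⟫_ℂ = c
    rw [key, mul_div_cancel_right₀ _ (inner_self_ne_zero.2 (refVec_ne_zero σ))]
  rw [key, h1]

theorem norm_intertwiningMap_apply [FiniteDimensional ℂ V] [IsIrreducible σ]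
    (hσ : ∀ g v w, ⟪σ g v, σ g w⟫_ℂ = ⟪v, w⟫_ℂ)
    (hρ : ∀ g v w, ⟪ρ g v, ρ g w⟫_ℂ = ⟪v, w⟫_ℂ)
    (ψ : IntertwiningMap σ ρ) (r : R) : ‖ψ r‖ = ‖ψ‖ * ‖r‖ := by
  have h := inner_intertwiningMap_apply hσ hρ ψ ψ r r
  simp only [inner_self_eq_norm_sq_to_K] at h
  rw [← mul_pow] at h
  norm_cast at h
  exact (pow_left_inj₀ (norm_nonneg _) (by positivity) two_ne_zero).1 h

/-- The inclusion of a subrepresentation. -/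
def Subrepresentation.subtype (W : Subrepresentation ρ) :
    IntertwiningMap W.toRepresentation ρ where
  toLinearMap := W.toSubmodule.subtype
  isIntertwining' _ := rfl

/-- A minimal nonzero subrepresentation is irreducible; one exists because submodules of `V` satisfy
the descending chain condition. -/
theorem Subrepresentation.exists_isIrreducible_le [FiniteDimensional ℂ V]
    (W : Subrepresentation ρ) (hW : W ≠ ⊥) :
    ∃ W' ≤ W, W'.toRepresentation.IsIrreducible := by
  have hwf : WellFounded ((· < ·) : Subrepresentation ρ → Subrepresentation ρ → Prop) :=
    Subrelation.wf (r := InvImage (· < ·) Subrepresentation.toSubmodule)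
      (fun {a b} h => h) (InvImage.wf _ wellFounded_lt)
  obtain ⟨W', ⟨hle, hne⟩, hmin⟩ := hwf.has_min {X | X ≤ W ∧ X ≠ ⊥} ⟨W, le_rfl, hW⟩
  refine ⟨W', hle, ?_⟩
  have hnt : Nontrivial (Subrepresentation W'.toRepresentation) := by
    refine ⟨⊥, ⊤, fun h => hne ?_⟩
    apply Subrepresentation.toSubmodule_injective
    have h' : (⊥ : Submodule ℂ W'.toSubmodule) = ⊤ :=
      congrArg Subrepresentation.toSubmodule h
    refine (Submodule.eq_bot_iff _).2 fun x hx => ?_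
    have : (⟨x, hx⟩ : W'.toSubmodule) ∈ (⊥ : Submodule ℂ W'.toSubmodule) := h' ▸ trivial
    simpa using this
  refine { eq_bot_or_eq_top := fun X => ?_ }
  -- Minimality concerns subrepresentations of `V`, so `X` is pushed forward along the inclusion.
  let Y : Subrepresentation ρ :=
    { toSubmodule := X.toSubmodule.map W'.toSubmodule.subtype
      apply_mem_toSubmodule := by
        rintro g _ ⟨x, hx, rfl⟩
        exact ⟨_, X.apply_mem_toSubmodule g hx, rfl⟩ }
  have hYW : Y ≤ W' := by
    rintro _ ⟨x, hx, rfl⟩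
    exact x.2
  by_cases hY : Y = ⊥
  · left
    apply Subrepresentation.toSubmodule_injective
    refine (Submodule.eq_bot_iff _).2 fun x hx => ?_
    have : (x : V) ∈ Y := ⟨x, hx, rfl⟩
    rw [hY] at this
    exact Subtype.ext this
  · right
    have : Y = W' := by
      by_contra hne'
      exact hmin Y ⟨hYW.trans hle, hY⟩ (lt_of_le_of_ne hYW hne')
    apply Subrepresentation.toSubmodule_injective
    refine eq_top_iff.2 fun x _ => ?_
    have hx : (x : V) ∈ Y.toSubmodule := by rw [this]; exact x.2
    obtain ⟨x', hx', h⟩ := Submodule.mem_map.1 hx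
    exact (Subtype.ext h : x' = x) ▸ hx'

/-- The orthogonal complement of a subrepresentation of a unitary representation. -/
noncomputable def Subrepresentation.orthogonal (hρ : ∀ g v w, ⟪ρ g v, ρ g w⟫_ℂ = ⟪v, w⟫_ℂ)
    (W : Subrepresentation ρ) : Subrepresentation ρ where
  toSubmodule := W.toSubmoduleᗮ
  apply_mem_toSubmodule g v hv := by
    rw [Submodule.mem_orthogonal'] at hv ⊢
    intro w hw
    rw [Representation.inner_apply_left hρ]
    exact hv _ (W.apply_mem_toSubmodule _ hw)

end Schur

/-! ### The unitary group of a finite-dimensional Hermitian space -/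

section UnitaryGroup

variable {E : Type*} [NormedAddCommGroup E] [InnerProductSpace ℂ E] [FiniteDimensional ℂ E]

namespace UGroup

theorem ext_apply {u w : UGroup E} (h : ∀ v, (u : E →L[ℂ] E) v = (w : E →L[ℂ] E) v) : u = w :=
  Subtype.ext (ContinuousLinearMap.ext h)

@[simp]
theorem inv_apply_apply (u : UGroup E) (v : E) :
    ((u⁻¹ : UGroup E) : E →L[ℂ] E) ((u : E →L[ℂ] E) v) = v := by
  rw [← mul_apply_eq_comp, ← Submonoid.coe_mul]; simp

@[simp]
theorem apply_inv_apply (u : UGroup E) (v : E) :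
    (u : E →L[ℂ] E) (((u⁻¹ : UGroup E) : E →L[ℂ] E) v) = v := by
  rw [← mul_apply_eq_comp, ← Submonoid.coe_mul]; simp

theorem mul_apply (u w : UGroup E) (v : E) :
    ((u * w : UGroup E) : E →L[ℂ] E) v = (u : E →L[ℂ] E) ((w : E →L[ℂ] E) v) := rfl

theorem exists_of_isometry (f : E →ₗ[ℂ] E) (hf : ∀ v w, ⟪f v, f w⟫_ℂ = ⟪v, w⟫_ℂ) :
    ∃ u : UGroup E, ∀ v, (u : E →L[ℂ] E) v = f v :=
  ⟨Unitary.linearIsometryEquiv.symm ((f.isometryOfInner hf).toLinearIsometryEquiv rfl),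
    fun _ => rfl⟩

theorem continuous_iff {X : Type*} [TopologicalSpace X] {f : X → UGroup E} :
    Continuous f ↔ ∀ v, Continuous fun x => (f x : E →L[ℂ] E) v := by
  rw [Topology.IsInducing.subtypeVal.continuous_iff]
  exact continuous_clm_apply

theorem continuous_apply (v : E) : Continuous fun u : UGroup E => (u : E →L[ℂ] E) v :=
  UGroup.continuous_iff.1 continuous_id v

/-- Compactness upgrades the continuous bijections below to homeomorphisms. -/
instance : CompactSpace (UGroup E) := by
  have : ProperSpace (E →L[ℂ] E) := FiniteDimensional.proper ℂ _
  have hb : Bornology.IsBounded (unitary (E →L[ℂ] E) : Set (E →L[ℂ] E)) := by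
    refine (Metric.isBounded_closedBall (x := (0 : E →L[ℂ] E)) (r := 1)).subset fun u hu => ?_
    rw [mem_closedBall_zero_iff]
    refine ContinuousLinearMap.opNorm_le_bound _ zero_le_one fun v => ?_
    rw [one_mul]
    exact (Unitary.norm_map ⟨u, hu⟩ v).le
  exact isCompact_iff_compactSpace.1 (Metric.isCompact_of_isClosed_isBounded isClosed_unitary hb)

end UGroup

end UnitaryGroup

/-! ### Dimension bounds and the existence of sector systems -/

/-- Produces families that cannot be lengthened: of inequivalent irreducibles, and later of vectors
adapted to an antiunitary operator. -/
theorem exists_and_not_succ_of_bounded {P : ℕ → Prop} (h0 : P 0) (N : ℕ)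
    (hN : ∀ m, P m → m ≤ N) : ∃ m, P m ∧ ¬ P (m + 1) := by
  by_contra! h
  have : ∀ m, P m := fun m => Nat.rec h0 (fun m hm => h m hm) m
  exact absurd (hN _ (this (N + 1))) (by omega)

theorem finite_of_orthogonal_ne_zero {V ι : Type*} [NormedAddCommGroup V] [InnerProductSpace ℂ V]
    [FiniteDimensional ℂ V] (v : ι → V) (h0 : ∀ i, v i ≠ 0)
    (h : Pairwise fun i j => ⟪v i, v j⟫_ℂ = 0) : Finite ι :=
  (linearIndependent_of_ne_zero_of_inner_eq_zero h0 h).finite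

namespace SymmetryAction

variable {G : Type*} [Group G] {V : Type*} [NormedAddCommGroup V] [InnerProductSpace ℂ V]
  (S : SymmetryAction G V)

theorem inner_rep (g : S.G₀) (v w : V) : ⟪S.rep g v, S.rep g w⟫_ℂ = ⟪v, w⟫_ℂ :=
  (S.unitary_of_mem g g.2).inner_map v w

theorem rep_apply (g : S.G₀) (v : V) : S.rep g v = S.ρ g v := rfl

theorem ρ_mul_apply (g h : G) (v : V) : S.ρ (g * h) v = S.ρ g (S.ρ h v) := by
  rw [map_mul]; rfl

@[simp]
theorem ρ_apply_inv_apply (g : G) (v : V) : S.ρ g (S.ρ g⁻¹ v) = v := by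
  rw [← S.ρ_mul_apply]; simp

@[simp]
theorem ρ_inv_apply_apply (g : G) (v : V) : S.ρ g⁻¹ (S.ρ g v) = v := by
  rw [← S.ρ_mul_apply]; simp

/-- Pairwise inequivalent irreducible subrepresentations. -/
def IsInequivalentFamily {m : ℕ} (W : Fin m → Subrepresentation S.rep) : Prop :=
  (∀ i, (W i).toRepresentation.IsIrreducible) ∧
    Pairwise fun i j => IsEmpty ((W i).toRepresentation.Equiv (W j).toRepresentation)

variable [FiniteDimensional ℂ V]

/-- Nonzero vectors picked one from each member are pairwise orthogonal. -/
theorem IsInequivalentFamily.le_finrank {S : SymmetryAction G V} {m : ℕ}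
    {W : Fin m → Subrepresentation S.rep} (hW : S.IsInequivalentFamily W) :
    m ≤ Module.finrank ℂ V := by
  have hirr := hW.1
  choose v hv using fun i => exists_ne_zero_of_isIrreducible (W i).toRepresentation
  have hli : LinearIndependent ℂ fun i => (v i : V) := by
    refine linearIndependent_of_ne_zero_of_inner_eq_zero
      (fun i h => hv i (Subtype.ext h)) fun i j hij => ?_
    exact inner_eq_zero_of_isEmpty_equiv (σ := (W j).toRepresentation) (σ' := (W i).toRepresentation)
      (fun g v w => S.inner_rep g v w) S.inner_rep (hW.2 hij.symm) (W i).subtype (W j).subtype (v i) (v j)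
  simpa using hli.fintype_card_le_finrank

/-- A family of inequivalent irreducible subspaces of `V` that cannot be lengthened is complete: an
irreducible subspace equivalent to no member could be prepended. -/
theorem exists_sectorSystem : ∃ (m : ℕ) (R : Fin m → Submodule ℂ V),
    Nonempty (SectorSystem S (Fin m) (fun l => R l)) := by
  obtain ⟨m, ⟨W, hW⟩, hmax⟩ := exists_and_not_succ_of_bounded
    (P := fun m => ∃ W : Fin m → Subrepresentation S.rep, S.IsInequivalentFamily W)
    ⟨Fin.elim0, fun i => i.elim0, fun i => i.elim0⟩ (Module.finrank ℂ V)
    (fun m ⟨_, hW⟩ => hW.le_finrank)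
  refine ⟨m, fun i => (W i).toSubmodule, ⟨?_⟩⟩
  exact
    { σ := fun i => (W i).toRepresentation
      unitary := fun l g r r' => S.inner_rep g r r'
      irreducible := hW.1
      inequivalent := fun l m' h => by
        by_contra hne
        exact not_isEmpty_iff.2 h (hW.2 hne)
      occurs := fun l => by
        have := hW.1 l
        obtain ⟨r, hr⟩ := exists_ne_zero_of_isIrreducible (W l).toRepresentation
        refine ⟨(W l).subtype, fun h => hr (Subtype.ext ?_)⟩
        exact congrArg (fun f => f r) h
      complete := fun X hX => by
        by_contra! hne
        refine hmax ⟨Fin.cons X W, ?_, ?_⟩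
        · intro i
          refine Fin.cases ?_ (fun i => ?_) i
          · exact hX
          · exact hW.1 i
        · intro i j
          refine Fin.cases ?_ (fun i => ?_) i <;> refine Fin.cases ?_ (fun j => ?_) j <;> intro hij
          · exact absurd rfl hij
          · exact ⟨fun e => (hne j).false e.symm⟩
          · exact hne i
          · exact hW.2 fun h => hij (congrArg Fin.succ h) }

end SymmetryAction

/-! ### Orthogonal decomposition of `V` into sectors -/

namespace SectorSystem

variable {G : Type*} [Group G] {V : Type*} [NormedAddCommGroup V] [InnerProductSpace ℂ V]
  {S : SymmetryAction G V} {Λ : Type*} {R : Λ → Type*}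
  [∀ l, NormedAddCommGroup (R l)] [∀ l, InnerProductSpace ℂ (R l)] (𝓡 : SectorSystem S Λ R)

theorem apply_mem_sector {l : Λ} (ψ : 𝓡.E l) (r : R l) : ψ r ∈ 𝓡.sector l :=
  Submodule.mem_iSup_of_mem ψ ⟨r, rfl⟩

theorem sector_induction {l : Λ} {p : V → Prop} (h : ∀ (ψ : 𝓡.E l) r, p (ψ r))
    (hadd : ∀ v w, p v → p w → p (v + w)) {v : V} (hv : v ∈ 𝓡.sector l) : p v :=
  Submodule.iSup_induction _ (motive := p) hv (by rintro ψ _ ⟨r, rfl⟩; exact h ψ r)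
    (by simpa using h (0 : 𝓡.E l) 0) hadd

theorem exists_norm_eq_one (l : Λ) : ∃ ψ : 𝓡.E l, ‖ψ‖ = 1 := by
  obtain ⟨ψ, hψ⟩ := 𝓡.occurs l
  have : Nontrivial (𝓡.E l) := nontrivial_of_ne ψ 0 hψ
  exact exists_norm_eq (𝓡.E l) zero_le_one

include 𝓡 in
theorem exists_vector_norm_eq_one (l : Λ) : ∃ r : R l, ‖r‖ = 1 := by
  obtain ⟨r, hr⟩ := exists_ne_zero_of_isIrreducible (𝓡.σ l)
  have : Nontrivial (R l) := nontrivial_of_ne r 0 hr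
  exact exists_norm_eq (R l) zero_le_one

variable [FiniteDimensional ℂ V]

include 𝓡 in
theorem finiteDimensional_R (l : Λ) : FiniteDimensional ℂ (R l) :=
  finiteDimensional_of_intertwiningMap_ne_zero (𝓡.occurs l).choose_spec

theorem inner_apply_apply {l : Λ} (ψ ψ' : 𝓡.E l) (r r' : R l) :
    ⟪ψ r, ψ' r'⟫_ℂ = ⟪ψ, ψ'⟫_ℂ * ⟪r, r'⟫_ℂ :=
  inner_intertwiningMap_apply (𝓡.unitary l) S.inner_rep ψ ψ' r r'

theorem norm_apply {l : Λ} (ψ : 𝓡.E l) (r : R l) : ‖ψ r‖ = ‖ψ‖ * ‖r‖ :=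
  norm_intertwiningMap_apply (𝓡.unitary l) S.inner_rep ψ r

theorem inner_apply_apply_of_ne {l m : Λ} (h : l ≠ m) (ψ : 𝓡.E l) (ψ' : 𝓡.E m)
    (r : R l) (r' : R m) : ⟪ψ r, ψ' r'⟫_ℂ = 0 :=
  inner_eq_zero_of_isEmpty_equiv (𝓡.unitary l) S.inner_rep
    (not_nonempty_iff.1 fun e => h (𝓡.inequivalent m l e).symm) ψ ψ' r r'

theorem eq_of_apply_mem_sector {l m : Λ} {ψ : 𝓡.E l} {r : R l} (h0 : ψ r ≠ 0)
    (h : ψ r ∈ 𝓡.sector m) : l = m := by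
  by_contra hne
  have : ∀ v ∈ 𝓡.sector m, ⟪ψ r, v⟫_ℂ = 0 := fun v hv =>
    𝓡.sector_induction (p := fun v => ⟪ψ r, v⟫_ℂ = 0)
      (fun ψ' r' => 𝓡.inner_apply_apply_of_ne hne ψ ψ' r r')
      (fun v w hv hw => by rw [inner_add_right, hv, hw, add_zero]) hv
  exact h0 (inner_self_eq_zero.1 (this _ h))

theorem pairwise_orthogonal : Pairwise fun l m => 𝓡.sector l ⟂ 𝓡.sector m := by
  intro l m hlm
  rw [Submodule.isOrtho_iff_inner_eq]
  intro v hv w hw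
  refine 𝓡.sector_induction (p := fun v => ⟪v, w⟫_ℂ = 0) (fun ψ r => ?_)
    (fun v w hv hw => by rw [inner_add_left, hv, hw, add_zero]) hv
  exact 𝓡.sector_induction (p := fun w => ⟪ψ r, w⟫_ℂ = 0)
    (fun ψ' r' => 𝓡.inner_apply_apply_of_ne hlm ψ ψ' r r')
    (fun v w hv hw => by rw [inner_add_right, hv, hw, add_zero]) hw

include 𝓡 in
theorem finite : Finite Λ := by
  choose ψ hψ using 𝓡.exists_norm_eq_one
  choose r hr using 𝓡.exists_vector_norm_eq_one
  refine finite_of_orthogonal_ne_zero (fun l => ψ l (r l)) (fun l => ?_)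
    fun l m h => 𝓡.inner_apply_apply_of_ne h _ _ _ _
  rw [← norm_ne_zero_iff, norm_apply, hψ, hr]
  simp

/-- The orthogonal complement of the sum of the sectors is invariant. If it were nonzero it would
contain an irreducible subspace, which by completeness is the image of some `R l`, hence lies in a
sector and is orthogonal to itself. -/
theorem iSup_sector : (⨆ l, 𝓡.sector l) = ⊤ := by
  let W : Subrepresentation S.rep :=
    { toSubmodule := ⨆ l, 𝓡.sector l
      apply_mem_toSubmodule := fun g v hv => by
        refine Submodule.iSup_induction _ (motive := fun v => S.rep g v ∈ ⨆ l, 𝓡.sector l) hv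
          (fun l v hv => ?_) (by simp) fun v w hv hw => ?_
        · refine 𝓡.sector_induction (p := fun v => S.rep g v ∈ ⨆ l, 𝓡.sector l)
            (fun ψ r => ?_) (fun v w hv hw => ?_) hv
          · rw [← ψ.isIntertwining]
            exact Submodule.mem_iSup_of_mem l (𝓡.apply_mem_sector ψ _)
          · rw [map_add]; exact add_mem hv hw
        · rw [map_add]; exact add_mem hv hw }
  by_contra hne
  have hW : W.orthogonal S.inner_rep ≠ ⊥ := fun h => hne <| by
    have h' := congrArg Subrepresentation.toSubmodule h
    exact (Submodule.orthogonal_eq_bot_iff).1 h'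
  obtain ⟨X, hX, hirr⟩ := Subrepresentation.exists_isIrreducible_le _ hW
  obtain ⟨l, ⟨e⟩⟩ := 𝓡.complete X hirr
  let ψ : 𝓡.E l := X.subtype.comp e.toIntertwiningMap
  obtain ⟨r, hr⟩ := exists_ne_zero_of_isIrreducible (𝓡.σ l)
  have h1 : ψ r ∈ W.toSubmodule := Submodule.mem_iSup_of_mem l (𝓡.apply_mem_sector ψ r)
  have h2 : ψ r ∈ W.toSubmoduleᗮ := hX (e r).2
  have h3 : ψ r = 0 := inner_self_eq_zero.1 ((Submodule.mem_orthogonal _ _).1 h2 _ h1)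
  have h4 : e r = 0 := Subtype.ext h3
  exact hr ((map_eq_zero_iff e e.toLinearEquiv.injective).1 h4)

theorem iSup_sector_induction {p : V → Prop} (h : ∀ l, ∀ v ∈ 𝓡.sector l, p v)
    (hadd : ∀ v w, p v → p w → p (v + w)) (h0 : p 0) (v : V) : p v :=
  Submodule.iSup_induction 𝓡.sector (motive := p) (𝓡.iSup_sector ▸ Submodule.mem_top) h h0 hadd

/-- Additive maps are used so that composites of `U` with the antilinear `T` are covered too. -/
theorem addHom_ext {f g : AddMonoid.End V} (h : ∀ l, ∀ v ∈ 𝓡.sector l, f v = g v) (v : V) :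
    f v = g v :=
  𝓡.iSup_sector_induction h (fun v w hv hw => by rw [map_add, map_add, hv, hw]) (by simp) v

end SectorSystem

/-! ### The centralizer of `G₀` -/

namespace SymmetryAction

variable {G : Type*} [Group G] {V : Type*} [NormedAddCommGroup V] [InnerProductSpace ℂ V]
  [FiniteDimensional ℂ V] {S : SymmetryAction G V}

theorem mem_unitaryCentralizer {U : UGroup V} : U ∈ S.unitaryCentralizer ↔
    ∀ g ∈ S.G₀, ∀ v, (U : V →L[ℂ] V) (S.ρ g v) = S.ρ g ((U : V →L[ℂ] V) v) := by
  refine forall₂_congr fun g _ => ⟨fun h v => ?_, fun h v => ?_⟩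
  · rw [h (S.ρ g v), ρ_inv_apply_apply]
  · rw [← h, ρ_apply_inv_apply]

/-- An element of the centralizer of `G₀`, as an intertwining operator. -/
noncomputable def toIntertwiningMap {U : UGroup V} (hU : U ∈ S.unitaryCentralizer) :
    Representation.IntertwiningMap S.rep S.rep where
  toLinearMap := ((U : V →L[ℂ] V) : V →ₗ[ℂ] V)
  isIntertwining' g := by
    ext v
    exact mem_unitaryCentralizer.1 hU g g.2 v

omit [FiniteDimensional ℂ V] in
theorem norm_ρ_apply (g : G) (v : V) : ‖S.ρ g v‖ = ‖v‖ := by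
  by_cases hg : g ∈ S.G₀
  · rw [@norm_eq_sqrt_re_inner ℂ, (S.unitary_of_mem g hg).inner_map, ← norm_eq_sqrt_re_inner]
  · rw [@norm_eq_sqrt_re_inner ℂ, (S.antiunitary_of_notMem g hg).inner_map, RCLike.conj_re,
      ← norm_eq_sqrt_re_inner]

omit [FiniteDimensional ℂ V] in
theorem continuous_ρ (g : G) : Continuous (S.ρ g) :=
  AddMonoidHomClass.continuous_of_bound (S.ρ g) 1 fun v => by rw [norm_ρ_apply, one_mul]

theorem isClosed_unitaryCentralizer : IsClosed (S.unitaryCentralizer : Set (UGroup V)) := by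
  have : (S.unitaryCentralizer : Set (UGroup V)) = ⋂ g : S.G₀, ⋂ v : V,
      {U : UGroup V | (U : V →L[ℂ] V) (S.ρ g v) = S.ρ g ((U : V →L[ℂ] V) v)} := by
    ext U
    simp [mem_unitaryCentralizer]
  rw [this]
  exact isClosed_iInter fun g => isClosed_iInter fun v => isClosed_eq
    (UGroup.continuous_apply _) ((continuous_ρ _).comp (UGroup.continuous_apply _))

instance : CompactSpace S.unitaryCentralizer :=
  isCompact_iff_compactSpace.1 isClosed_unitaryCentralizer.isCompact

end SymmetryAction

namespace SectorSystem

open SymmetryAction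

variable {G : Type*} [Group G] {V : Type*} [NormedAddCommGroup V] [InnerProductSpace ℂ V]
  {S : SymmetryAction G V} {Λ : Type*} {R : Λ → Type*}
  [∀ l, NormedAddCommGroup (R l)] [∀ l, InnerProductSpace ℂ (R l)] {𝓡 : SectorSystem S Λ R}
  [FiniteDimensional ℂ V]

theorem ActsAs.eq {l : Λ} {U : UGroup V} {x y : UGroup (𝓡.E l)} (hx : 𝓡.ActsAs U x)
    (hy : 𝓡.ActsAs U y) : x = y :=
  UGroup.ext_apply fun ψ => Representation.IntertwiningMap.ext <| LinearMap.ext fun r =>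
    (hx ψ r).trans (hy ψ r).symm

theorem ActsAs.mul {l : Λ} {U W : UGroup V} {x y : UGroup (𝓡.E l)} (hx : 𝓡.ActsAs U x)
    (hy : 𝓡.ActsAs W y) : 𝓡.ActsAs (U * W) (x * y) := fun ψ r => by
  rw [UGroup.mul_apply, UGroup.mul_apply, hx, hy]

theorem ActsAs.inv {l : Λ} {U : UGroup V} {x : UGroup (𝓡.E l)} (hx : 𝓡.ActsAs U x) :
    𝓡.ActsAs U⁻¹ x⁻¹ := fun ψ r => by
  have h := hx (((x⁻¹ : UGroup (𝓡.E l)) : 𝓡.E l →L[ℂ] 𝓡.E l) ψ) r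
  rw [UGroup.apply_inv_apply] at h
  rw [h, UGroup.inv_apply_apply]

theorem ActsAs.apply_mem_sector {l : Λ} {U : UGroup V} {x : UGroup (𝓡.E l)}
    (hx : 𝓡.ActsAs U x) {v : V} (hv : v ∈ 𝓡.sector l) : (U : V →L[ℂ] V) v ∈ 𝓡.sector l := by
  refine 𝓡.sector_induction (p := fun v => (U : V →L[ℂ] V) v ∈ 𝓡.sector l) (fun ψ r => ?_)
    (fun v w hv hw => by rw [map_add]; exact add_mem hv hw) hv
  rw [← hx]
  exact 𝓡.apply_mem_sector _ _

theorem ActsAs.eqOn_sector {l : Λ} {U W : UGroup V} {x : UGroup (𝓡.E l)} (hU : 𝓡.ActsAs U x)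
    (hW : 𝓡.ActsAs W x) {v : V} (hv : v ∈ 𝓡.sector l) :
    (U : V →L[ℂ] V) v = (W : V →L[ℂ] V) v :=
  𝓡.sector_induction (p := fun v => (U : V →L[ℂ] V) v = (W : V →L[ℂ] V) v)
    (fun ψ r => (hU ψ r).symm.trans (hW ψ r))
    (fun v w hv hw => by rw [map_add, map_add, hv, hw]) hv

variable (𝓡)

theorem eq_of_eqOn_sectors {U W : UGroup V}
    (h : ∀ l, ∀ v ∈ 𝓡.sector l, (U : V →L[ℂ] V) v = (W : V →L[ℂ] V) v) : U = W :=
  UGroup.ext_apply fun v => 𝓡.addHom_ext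
    (f := ((U : V →L[ℂ] V) : V →ₗ[ℂ] V).toAddMonoidHom)
    (g := ((W : V →L[ℂ] V) : V →ₗ[ℂ] V).toAddMonoidHom) h v

/-- `U` acts on `E l` by composition on the left; evaluation at a unit vector `r` embeds `E l`
isometrically in `V`, so unitarity is inherited. -/
theorem exists_actsAs {U : UGroup V} (hU : U ∈ S.unitaryCentralizer) (l : Λ) :
    ∃ x : UGroup (𝓡.E l), 𝓡.ActsAs U x := by
  obtain ⟨r, hr⟩ := 𝓡.exists_vector_norm_eq_one l
  have hrr : ⟪r, r⟫_ℂ = 1 := by rw [inner_self_eq_norm_sq_to_K, hr]; simp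
  let f : 𝓡.E l →ₗ[ℂ] 𝓡.E l :=
    { toFun := fun ψ => (toIntertwiningMap hU).comp ψ
      map_add' := fun ψ ψ' => by
        ext s
        exact map_add (U : V →L[ℂ] V) (ψ s) (ψ' s)
      map_smul' := fun z ψ => by
        ext s
        exact map_smul (U : V →L[ℂ] V) z (ψ s) }
  obtain ⟨x, hx⟩ := UGroup.exists_of_isometry f fun ψ ψ' => by
    have h1 := 𝓡.inner_apply_apply (f ψ) (f ψ') r r
    have h2 := 𝓡.inner_apply_apply ψ ψ' r r
    rw [hrr, mul_one] at h1 h2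
    rw [← h1, ← h2]
    exact Unitary.inner_map_map U _ _
  exact ⟨x, fun ψ s => by rw [hx]; rfl⟩

theorem exists_linearMap_of_sector (l : Λ) (y : 𝓡.E l →L[ℂ] 𝓡.E l) : ∃ A : V →ₗ[ℂ] V,
    (∀ (ψ : 𝓡.E l) r, A (ψ r) = (y ψ) r) ∧
      ∀ m, m ≠ l → ∀ (ψ : 𝓡.E m) r, A (ψ r) = 0 := by
  have := 𝓡.finiteDimensional_R l
  let e := stdOrthonormalBasis ℂ (𝓡.E l)
  let b := stdOrthonormalBasis ℂ (R l)
  -- The vectors `e i (b j)` are orthonormal and span the sector; `A` sends each of them to `y (e i)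
  -- (b j)` and kills their orthogonal complement.
  let A : V →ₗ[ℂ] V := ∑ i, ∑ j, (innerₛₗ ℂ (e i (b j))).smulRight (y (e i) (b j))
  have hA : ∀ v, A v = ∑ i, ∑ j, ⟪e i (b j), v⟫_ℂ • y (e i) (b j) := fun v => by
    simp [A, LinearMap.sum_apply]
  refine ⟨A, fun ψ r => ?_, fun m hm ψ r => ?_⟩
  · rw [hA]
    conv_rhs => rw [← e.sum_repr' ψ, ← b.sum_repr' r]
    rw [map_sum y, Representation.IntertwiningMap.sum_apply]
    refine Finset.sum_congr rfl fun i _ => ?_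
    rw [map_sum]
    refine Finset.sum_congr rfl fun j _ => ?_
    rw [𝓡.inner_apply_apply, map_smul, map_smul, Representation.IntertwiningMap.smul_apply,
      smul_smul, mul_comm]
  · rw [hA]
    refine Finset.sum_eq_zero fun i _ => Finset.sum_eq_zero fun j _ => ?_
    rw [𝓡.inner_apply_apply_of_ne hm.symm, zero_smul]

theorem exists_mem_unitaryCentralizer (x : ∀ l, UGroup (𝓡.E l)) :
    ∃ U ∈ S.unitaryCentralizer, ∀ l, 𝓡.ActsAs U (x l) := by
  have := 𝓡.finite
  have := Fintype.ofFinite Λ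
  choose A hA hA' using fun l => 𝓡.exists_linearMap_of_sector l (x l : 𝓡.E l →L[ℂ] 𝓡.E l)
  have hsum : ∀ l (ψ : 𝓡.E l) r,
      (∑ m, A m) (ψ r) = ((x l : 𝓡.E l →L[ℂ] 𝓡.E l) ψ) r := fun l ψ r => by
    rw [LinearMap.sum_apply, Finset.sum_eq_single l (fun m _ hm => hA' m l hm.symm ψ r)
      (fun h => absurd (Finset.mem_univ l) h), hA]
  -- Additivity in each argument reduces isometry to pairs `ψ r`, `ψ' r'`, where the product formula
  -- and cross-sector orthogonality decide it.
  obtain ⟨U, hU⟩ := UGroup.exists_of_isometry (∑ m, A m) fun v w => by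
    refine 𝓡.iSup_sector_induction
      (p := fun v => ⟪(∑ m, A m) v, (∑ m, A m) w⟫_ℂ = ⟪v, w⟫_ℂ) (fun l v hv => ?_)
      (fun v v' h h' => by rw [map_add, inner_add_left, inner_add_left, h, h']) (by simp) v
    refine 𝓡.sector_induction (p := fun v => ⟪(∑ m, A m) v, (∑ m, A m) w⟫_ℂ = ⟪v, w⟫_ℂ)
      (fun ψ r => ?_)
      (fun v v' h h' => by rw [map_add, inner_add_left, inner_add_left, h, h']) hv
    refine 𝓡.iSup_sector_induction
      (p := fun w => ⟪(∑ m, A m) (ψ r), (∑ m, A m) w⟫_ℂ = ⟪ψ r, w⟫_ℂ) (fun m v hv => ?_)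
      (fun v v' h h' => by rw [map_add, inner_add_right, inner_add_right, h, h']) (by simp) w
    refine 𝓡.sector_induction
      (p := fun w => ⟪(∑ m, A m) (ψ r), (∑ m, A m) w⟫_ℂ = ⟪ψ r, w⟫_ℂ) (fun ψ' r' => ?_)
      (fun v v' h h' => by rw [map_add, inner_add_right, inner_add_right, h, h']) hv
    rw [hsum, hsum]
    by_cases hlm : l = m
    · subst hlm
      rw [𝓡.inner_apply_apply, 𝓡.inner_apply_apply, Unitary.inner_map_map]
    · rw [𝓡.inner_apply_apply_of_ne hlm, 𝓡.inner_apply_apply_of_ne hlm]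
  have hact : ∀ l, 𝓡.ActsAs U (x l) := fun l ψ r => by rw [hU, hsum]
  refine ⟨U, mem_unitaryCentralizer.2 fun g hg v => ?_, hact⟩
  refine 𝓡.addHom_ext (f := ((U : V →L[ℂ] V) : V →ₗ[ℂ] V).toAddMonoidHom.comp (S.ρ g))
    (g := (S.ρ g).comp ((U : V →L[ℂ] V) : V →ₗ[ℂ] V).toAddMonoidHom) (fun l v hv => ?_) v
  refine 𝓡.sector_induction (p := fun v => (U : V →L[ℂ] V) (S.ρ g v) =
    S.ρ g ((U : V →L[ℂ] V) v)) (fun ψ r => ?_)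
    (fun v w h h' => by rw [map_add, map_add, map_add, map_add, h, h']) hv
  have h1 : ∀ χ : 𝓡.E l, S.ρ g (χ r) = χ (𝓡.σ l (⟨g, hg⟩ : S.G₀) r) := fun χ =>
    (Representation.IntertwiningMap.isIntertwining _ _ χ (⟨g, hg⟩ : S.G₀) r).symm
  rw [h1, ← hact l, ← hact l, h1]

/-- The component on the sector `V l` of an element of the centralizer of `G₀`. -/
noncomputable def component (U : S.unitaryCentralizer) (l : Λ) : UGroup (𝓡.E l) :=
  (𝓡.exists_actsAs U.2 l).choose

theorem actsAs_component (U : S.unitaryCentralizer) (l : Λ) :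
    𝓡.ActsAs (U : UGroup V) (𝓡.component U l) :=
  (𝓡.exists_actsAs U.2 l).choose_spec

/-- Evaluation at a unit vector is an isometric embedding of `E l`, so continuity can be tested
inside `V`. -/
theorem continuous_of_actsAs {X : Type*} [TopologicalSpace X] {u : X → UGroup V}
    (hu : Continuous u) {l : Λ} {x : X → UGroup (𝓡.E l)} (h : ∀ t, 𝓡.ActsAs (u t) (x t)) :
    Continuous x := by
  obtain ⟨r, hr⟩ := 𝓡.exists_vector_norm_eq_one l
  rw [UGroup.continuous_iff] at hu ⊢
  intro ψ
  let ev : 𝓡.E l →ₗᵢ[ℂ] V :=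
    { toFun := fun ψ => ψ r
      map_add' := fun _ _ => rfl
      map_smul' := fun _ _ => rfl
      norm_map' := fun ψ => by
        change ‖ψ r‖ = ‖ψ‖
        rw [𝓡.norm_apply, hr, mul_one] }
  rw [ev.isometry.isEmbedding.continuous_iff]
  exact (hu (ψ r)).congr fun t => (h t ψ r).symm

/-- Restriction to the sectors, as an isomorphism of topological groups. -/
theorem exists_continuousMulEquiv : ∃ Φ : S.unitaryCentralizer ≃ₜ* (∀ l, UGroup (𝓡.E l)),
    ∀ (U : S.unitaryCentralizer) (l : Λ), 𝓡.ActsAs (U : UGroup V) (Φ U l) := by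
  let f : S.unitaryCentralizer →* (∀ l, UGroup (𝓡.E l)) :=
    MonoidHom.mk' 𝓡.component fun U W => funext fun l =>
      (𝓡.actsAs_component (U * W) l).eq
        ((𝓡.actsAs_component U l).mul (𝓡.actsAs_component W l))
  have hf : Function.Bijective f := by
    refine ⟨fun U W h => Subtype.ext (𝓡.eq_of_eqOn_sectors fun l v hv => ?_), fun x => ?_⟩
    · refine (𝓡.actsAs_component U l).eqOn_sector ?_ hv
      rw [show 𝓡.component U l = 𝓡.component W l from congrFun h l]
      exact 𝓡.actsAs_component W l
    · obtain ⟨U, hU, hx⟩ := 𝓡.exists_mem_unitaryCentralizer x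
      exact ⟨⟨U, hU⟩, funext fun l => (𝓡.actsAs_component ⟨U, hU⟩ l).eq (hx l)⟩
  have hc : Continuous f := continuous_pi fun l =>
    𝓡.continuous_of_actsAs continuous_subtype_val fun U => 𝓡.actsAs_component U l
  let e := MulEquiv.ofBijective f hf
  exact ⟨{ e with
    continuous_toFun := hc
    continuous_invFun := (hc.homeoOfEquivCompactToT2 (f := e.toEquiv)).symm.continuous },
    𝓡.actsAs_component⟩

end SectorSystem

/-! ### Antiunitary symmetries -/

theorem LinearIsometryEquiv.exists_of_antilinear {E F : Type*} [NormedAddCommGroup E]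
    [NormedSpace ℂ E] [NormedAddCommGroup F] [NormedSpace ℂ F] (f : E → F)
    (hadd : ∀ v w, f (v + w) = f v + f w)
    (hsmul : ∀ (z : ℂ) v, f (z • v) = (starRingEnd ℂ) z • f v) (hnorm : ∀ v, ‖f v‖ = ‖v‖)
    (hsurj : Function.Surjective f) : ∃ e : E ≃ₗᵢ⋆[ℂ] F, ∀ v, e v = f v := by
  let L : E →ₗ⋆[ℂ] F := { toFun := f, map_add' := hadd, map_smul' := hsmul }
  have hinj : Function.Injective L := by
    rw [injective_iff_map_eq_zero]
    intro v hv
    rw [← norm_eq_zero, ← hnorm]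
    exact norm_eq_zero.2 hv
  exact ⟨{ LinearEquiv.ofBijective L ⟨hinj, hsurj⟩ with norm_map' := hnorm }, fun _ => rfl⟩

/-- Isometry gives `‖c‖ = 1`. Computing `α³` in two ways pulls `c` through the antilinear `α` and
makes it real. -/
theorem eq_one_or_eq_neg_one_of_antiunitary_sq {E : Type*} [NormedAddCommGroup E]
    [NormedSpace ℂ E] [Nontrivial E] (α : E ≃ₗᵢ⋆[ℂ] E) (c : ℂ) (h : ∀ v, α (α v) = c • v) :
    c = 1 ∨ c = -1 := by
  obtain ⟨v, hv⟩ := exists_norm_eq E zero_le_one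
  have h1 : ‖c‖ = 1 := by
    have := congrArg norm (h v)
    rwa [α.norm_map, α.norm_map, norm_smul, hv, mul_one, eq_comm] at this
  have h2 : (starRingEnd ℂ) c = c := by
    have h3 : α (α (α v)) = (starRingEnd ℂ) c • α v := by rw [h v, map_smulₛₗ]
    rw [h (α v)] at h3
    have h0 : α v ≠ 0 := fun h0 => by
      rw [← norm_eq_zero, α.norm_map, hv] at h0
      exact one_ne_zero h0
    exact (smul_left_injective ℂ h0 h3).symm
  obtain ⟨t, rfl⟩ := Complex.conj_eq_iff_real.1 h2
  rw [Complex.norm_real] at h1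
  rcases (abs_eq zero_le_one).1 h1 with rfl | rfl <;> simp

theorem exists_intUnit_smul_eq {c : ℂ} (h : c = 1 ∨ c = -1) :
    ∃ ε : ℤˣ, c = ((ε : ℤ) : ℂ) := by
  rcases h with rfl | rfl
  · exact ⟨1, by simp⟩
  · exact ⟨-1, by simp⟩

theorem intCast_units_smul {M : Type*} [AddCommGroup M] [Module ℂ M] (ε : ℤˣ) (v : M) :
    ((ε : ℤ) : ℂ) • v = ε • v := by
  rw [Units.smul_def, Int.cast_smul_eq_zsmul]

namespace SymmetryAction

variable {G : Type*} [Group G] {V : Type*} [NormedAddCommGroup V] [InnerProductSpace ℂ V]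
  {S : SymmetryAction G V} {T : G}

theorem inv_notMem (hT : T ∉ S.G₀) : T⁻¹ ∉ S.G₀ := fun h => hT (inv_mem_iff.1 h)

/-- `T⁻¹` lies in the same coset, so `T⁻¹ = T h` with `h ∈ G₀`. -/
theorem mul_self_mem (hT : T ∉ S.G₀) : T * T ∈ S.G₀ := by
  obtain ⟨h, hh, e⟩ := S.mem_coset T hT _ (inv_notMem hT)
  have : T * T = h⁻¹ := by
    rw [eq_inv_iff_mul_eq_one, mul_assoc, ← e, mul_inv_cancel]
  rw [this]
  exact inv_mem hh

theorem conj_mem (hT : T ∉ S.G₀) {g : G} (hg : g ∈ S.G₀) : T⁻¹ * g * T ∈ S.G₀ := by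
  obtain ⟨h, hh, e⟩ := S.mem_coset T hT (g * T) fun h => hT ((Subgroup.mul_mem_cancel_left _ hg).1 h)
  rwa [mul_assoc, e, inv_mul_cancel_left]

theorem ρ_conj_apply (g : G) (v : V) : S.ρ T (S.ρ (T⁻¹ * g * T) v) = S.ρ g (S.ρ T v) := by
  rw [← ρ_mul_apply, ← ρ_mul_apply, mul_assoc, mul_inv_cancel_left]

/-- An antiunitary symmetry as an antilinear isometric equivalence. -/
theorem exists_antiunitary (hT : T ∉ S.G₀) : ∃ t : V ≃ₗᵢ⋆[ℂ] V, ∀ v, t v = S.ρ T v :=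
  LinearIsometryEquiv.exists_of_antilinear (S.ρ T) (map_add (S.ρ T))
    (S.antiunitary_of_notMem T hT).map_smul (fun v => norm_ρ_apply T v)
    fun v => ⟨S.ρ T⁻¹ v, by simp⟩

variable [FiniteDimensional ℂ V]

theorem mem_compatible_iff_of_eq_top (h : S.G₀ = ⊤) {U : UGroup V} :
    U ∈ S.compatible ↔ U ∈ S.unitaryCentralizer :=
  ⟨fun hU => hU.1, fun hU => ⟨hU, fun g hg => absurd (h ▸ Subgroup.mem_top g) hg⟩⟩

/-- The single equation `U T U = T` suffices: every other element outside `G₀` is `T h`, and `U`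
commutes with `h`. -/
theorem mem_compatible_iff (hT : T ∉ S.G₀) {U : UGroup V} :
    U ∈ S.compatible ↔ U ∈ S.unitaryCentralizer ∧
      ∀ v, (U : V →L[ℂ] V) (S.ρ T ((U : V →L[ℂ] V) v)) = S.ρ T v := by
  refine ⟨fun hU => ⟨hU.1, fun v => ?_⟩, fun hU => ⟨hU.1, fun g hg v => ?_⟩⟩
  · rw [hU.2 T hT, ρ_inv_apply_apply, UGroup.inv_apply_apply]
  · obtain ⟨h, hh, rfl⟩ := S.mem_coset T hT g hg
    have h1 := mem_unitaryCentralizer.1 hU.1 h hh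
      (((U⁻¹ : UGroup V) : V →L[ℂ] V) (S.ρ (T * h)⁻¹ v))
    have h2 := hU.2 (S.ρ h (((U⁻¹ : UGroup V) : V →L[ℂ] V) (S.ρ (T * h)⁻¹ v)))
    rw [h1, UGroup.apply_inv_apply, ← S.ρ_mul_apply T h, ← S.ρ_mul_apply T h, ρ_apply_inv_apply] at h2
    exact h2

theorem isClosed_compatible : IsClosed S.compatible := by
  have : S.compatible = (S.unitaryCentralizer : Set (UGroup V)) ∩
      ⋂ g : {g // g ∉ S.G₀}, ⋂ v : V, {U : UGroup V | (U : V →L[ℂ] V) v =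
        S.ρ g (((U⁻¹ : UGroup V) : V →L[ℂ] V) (S.ρ (g : G)⁻¹ v))} := by
    ext U
    simp [compatible, unitaryCentralizer]
  rw [this]
  exact isClosed_unitaryCentralizer.inter <| isClosed_iInter fun g => isClosed_iInter fun v =>
    isClosed_eq (UGroup.continuous_apply _)
      ((continuous_ρ _).comp ((UGroup.continuous_apply _).comp continuous_inv))

instance : CompactSpace S.compatible :=
  isCompact_iff_compactSpace.1 isClosed_compatible.isCompact

/-- With `U = W T W⁻¹ T⁻¹` one finds `U T U = W T² W⁻¹ T⁻¹`, which equals `T` because `W` commutes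
with `T² ∈ G₀`. -/
theorem mul_tau_inv_mem_compatible (hT : T ∉ S.G₀) {t : V ≃ₗᵢ⋆[ℂ] V} (ht : ∀ v, t v = S.ρ T v)
    {W : UGroup V} (hW : W ∈ S.unitaryCentralizer) : W * tau t W⁻¹ ∈ S.compatible := by
  have ht' : ∀ v, t.symm v = S.ρ T⁻¹ v := fun v => by
    rw [t.symm_apply_eq, ht, ρ_apply_inv_apply]
  have hW' := mem_unitaryCentralizer.1 hW
  have hWi := mem_unitaryCentralizer.1 (inv_mem hW)
  refine (mem_compatible_iff hT).2 ⟨mem_unitaryCentralizer.2 fun g hg v => ?_, fun v => ?_⟩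
  · simp only [UGroup.mul_apply, tau_apply, ht, ht']
    have h1 := ρ_conj_apply (S := S) (T := T) g (S.ρ T⁻¹ v)
    rw [ρ_apply_inv_apply] at h1
    rw [← hW' g hg, ← h1, ρ_inv_apply_apply, hWi _ (conj_mem hT hg), ρ_conj_apply]
  · simp only [UGroup.mul_apply, tau_apply, ht, ht']
    rw [ρ_inv_apply_apply, UGroup.inv_apply_apply, ← ρ_mul_apply, hW' _ (mul_self_mem hT),
      UGroup.apply_inv_apply, ρ_mul_apply, ρ_apply_inv_apply]

end SymmetryAction

/-! ### Action of `T` on the sectors and determination of the factors -/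

namespace SectorSystem

open SymmetryAction

variable {G : Type*} [Group G] {V : Type*} [NormedAddCommGroup V] [InnerProductSpace ℂ V]
  {S : SymmetryAction G V} {Λ : Type*} {R : Λ → Type*}
  [∀ l, NormedAddCommGroup (R l)] [∀ l, InnerProductSpace ℂ (R l)] {𝓡 : SectorSystem S Λ R}
  [FiniteDimensional ℂ V] {T : G}

theorem ActsAs.congr {l : Λ} {U W : UGroup V} {x : UGroup (𝓡.E l)} (hU : 𝓡.ActsAs U x)
    (h : ∀ v ∈ 𝓡.sector l, (W : V →L[ℂ] V) v = (U : V →L[ℂ] V) v) : 𝓡.ActsAs W x :=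
  fun ψ r => by rw [hU, h _ (𝓡.apply_mem_sector ψ r)]

theorem actsAs_one (l : Λ) : 𝓡.ActsAs 1 (1 : UGroup (𝓡.E l)) := fun _ _ => rfl

variable (𝓡)

/-- Reduces the product decomposition to uniqueness and gluing of operators on `V`; compactness
makes the bijection a homeomorphism. -/
theorem isProductOfFactors (Ω : Set Λ)
    (hinj : ∀ U ∈ S.compatible, ∀ W ∈ S.compatible,
      (∀ l ∈ Ω, ∀ v ∈ 𝓡.sector l, (U : V →L[ℂ] V) v = (W : V →L[ℂ] V) v) → U = W)
    (hsurj : ∀ u : Ω → UGroup V, (∀ l, u l ∈ S.compatible) → ∃ U ∈ S.compatible,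
      ∀ l : Ω, ∀ v ∈ 𝓡.sector l, (U : V →L[ℂ] V) v = (u l : V →L[ℂ] V) v) :
    𝓡.IsProductOfFactors Ω := by
  have hact : ∀ (U : S.compatible) (l : Ω),
      𝓡.ActsAs (U : UGroup V) (𝓡.component ⟨U, U.2.1⟩ (l : Λ)) :=
    fun U l => 𝓡.actsAs_component ⟨U, U.2.1⟩ l
  let f : S.compatible → ∀ l : Ω, 𝓡.factor l := fun U l => ⟨_, U, U.2, hact U l⟩
  have hc : Continuous f := continuous_pi fun l =>
    (𝓡.continuous_of_actsAs continuous_subtype_val fun U => hact U l).subtype_mk _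
  have hf : Function.Bijective f := by
    refine ⟨fun U W h => Subtype.ext (hinj U U.2 W W.2 fun l hl v hv => ?_), fun x => ?_⟩
    · refine (hact U ⟨l, hl⟩).eqOn_sector ?_ hv
      have h' : 𝓡.component ⟨U, U.2.1⟩ l = 𝓡.component ⟨W, W.2.1⟩ l :=
        congrArg Subtype.val (congrFun h ⟨l, hl⟩)
      rw [h']
      exact hact W ⟨l, hl⟩
    · choose u hu hx using fun l => (x l).2
      obtain ⟨U, hU, h⟩ := hsurj u hu
      exact ⟨⟨U, hU⟩, funext fun l => Subtype.ext
        ((hact ⟨U, hU⟩ l).eq ((hx l).congr (h l)))⟩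
  exact ⟨hc.homeoOfEquivCompactToT2 (f := Equiv.ofBijective f hf), hact⟩

theorem factor_eq_univ_of_eq_top (h : S.G₀ = ⊤) (l : Λ) : 𝓡.factor l = Set.univ := by
  classical
  refine Set.eq_univ_of_forall fun x => ?_
  obtain ⟨U, hU, hx⟩ := 𝓡.exists_mem_unitaryCentralizer (Function.update 1 l x)
  refine ⟨U, (mem_compatible_iff_of_eq_top h).2 hU, ?_⟩
  simpa using hx l

theorem isProductOfFactors_of_eq_top (h : S.G₀ = ⊤) : 𝓡.IsProductOfFactors Set.univ := by
  refine 𝓡.isProductOfFactors _ (fun U _ W _ hUW => 𝓡.eq_of_eqOn_sectors fun l =>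
    hUW l trivial) fun u hu => ?_
  obtain ⟨U, hU, hx⟩ := 𝓡.exists_mem_unitaryCentralizer
    fun l => 𝓡.component ⟨u ⟨l, trivial⟩, (hu _).1⟩ l
  exact ⟨U, (mem_compatible_iff_of_eq_top h).2 hU, fun l v hv =>
    (hx l).eqOn_sector (𝓡.actsAs_component ⟨u ⟨l, trivial⟩, (hu _).1⟩ l) hv⟩

omit [FiniteDimensional ℂ V] in
theorem apply_rep {l : Λ} (ψ : 𝓡.E l) (g : S.G₀) (r : R l) :
    ψ (𝓡.σ l g r) = S.ρ g (ψ r) :=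
  Representation.IntertwiningMap.isIntertwining _ _ ψ g r

/-- An antiunitary symmetry carries an irreducible subspace of the sector `V l` to the image of
some `R m`. -/
theorem exists_norm_eq_one_and_image_eq (hT : T ∉ S.G₀) {l : Λ} {ψ : 𝓡.E l} (hψ : ‖ψ‖ = 1) :
    ∃ (m : Λ) (χ : 𝓡.E m), ‖χ‖ = 1 ∧ (∀ r, ∃ s, χ s = S.ρ T (ψ r)) ∧
      ∀ s, ∃ r, χ s = S.ρ T (ψ r) := by
  have hanti := S.antiunitary_of_notMem T hT
  let W : Subrepresentation S.rep :=
    { toSubmodule :=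
        { carrier := {v | ∃ r, v = S.ρ T (ψ r)}
          zero_mem' := ⟨0, by simp⟩
          add_mem' := by
            rintro _ _ ⟨r, rfl⟩ ⟨s, rfl⟩
            exact ⟨r + s, by rw [map_add, map_add]⟩
          smul_mem' := by
            rintro z _ ⟨r, rfl⟩
            exact ⟨(starRingEnd ℂ) z • r, by rw [map_smul, hanti.map_smul, Complex.conj_conj]⟩ }
      apply_mem_toSubmodule := by
        rintro g _ ⟨r, rfl⟩
        refine ⟨𝓡.σ l ⟨_, conj_mem hT g.2⟩ r, ?_⟩
        rw [apply_rep, ρ_conj_apply, rep_apply] }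
  have hnorm : ∀ r, ‖S.ρ T (ψ r)‖ = ‖r‖ := fun r => by
    rw [norm_ρ_apply, 𝓡.norm_apply, hψ, one_mul]
  have hW : W ≠ ⊥ := fun h => by
    obtain ⟨r, hr⟩ := 𝓡.exists_vector_norm_eq_one l
    have h1 : S.ρ T (ψ r) ∈ W := ⟨r, rfl⟩
    rw [h] at h1
    have h2 : S.ρ T (ψ r) = 0 := h1
    rw [← norm_eq_zero, hnorm, hr] at h2
    exact one_ne_zero h2
  obtain ⟨X, hX, hirr⟩ := Subrepresentation.exists_isIrreducible_le _ hW
  obtain ⟨m, ⟨e⟩⟩ := 𝓡.complete X hirr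
  -- The preimage of `X` under `r ↦ T (ψ r)` is nonzero, hence all of `R l`; so `X` is the whole
  -- image.
  let P : Subrepresentation (𝓡.σ l) :=
    { toSubmodule :=
        { carrier := {r | S.ρ T (ψ r) ∈ X.toSubmodule}
          zero_mem' := by simp
          add_mem' := fun {r s} hr hs => by
            change S.ρ T (ψ (r + s)) ∈ X.toSubmodule
            rw [map_add, map_add]
            exact add_mem hr hs
          smul_mem' := fun z r hr => by
            change S.ρ T (ψ (z • r)) ∈ X.toSubmodule
            rw [map_smul, hanti.map_smul]
            exact Submodule.smul_mem _ _ hr }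
      apply_mem_toSubmodule := fun g r hr => by
        change S.ρ T (ψ (𝓡.σ l g r)) ∈ X.toSubmodule
        have h1 := conj_mem (inv_notMem hT) g.2
        rw [inv_inv] at h1
        have h2 : S.ρ T (S.ρ g (ψ r)) = S.ρ (T * g * T⁻¹) (S.ρ T (ψ r)) := by
          rw [← ρ_mul_apply, ← ρ_mul_apply, inv_mul_cancel_right]
        rw [apply_rep, h2]
        exact X.apply_mem_toSubmodule ⟨_, h1⟩ hr }
  have hP : P = ⊤ := by
    refine (eq_bot_or_eq_top P).resolve_left fun h => ?_
    obtain ⟨s, hs⟩ := 𝓡.exists_vector_norm_eq_one m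
    obtain ⟨r, hr⟩ := hX (e s).2
    have h1 : r ∈ P := by
      change S.ρ T (ψ r) ∈ X.toSubmodule
      rw [← hr]
      exact (e s).2
    rw [h] at h1
    have h2 : r = 0 := h1
    have h3 : e s = 0 := Subtype.ext (by rw [hr, h2]; simp)
    rw [(map_eq_zero_iff e e.toLinearEquiv.injective).1 h3, norm_zero] at hs
    exact zero_ne_one hs
  have hmem : ∀ r, S.ρ T (ψ r) ∈ X.toSubmodule := fun r => by
    have : r ∈ P := by rw [hP]; trivial
    exact this
  let χ : 𝓡.E m := X.subtype.comp e.toIntertwiningMap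
  have hχ : ∀ s, χ s = (e s : V) := fun s => rfl
  have hχ0 : ‖χ‖ ≠ 0 := fun h => by
    obtain ⟨s, hs⟩ := 𝓡.exists_vector_norm_eq_one m
    have h1 := 𝓡.norm_apply χ s
    rw [h, zero_mul, norm_eq_zero] at h1
    have h3 : e s = 0 := Subtype.ext h1
    rw [(map_eq_zero_iff e e.toLinearEquiv.injective).1 h3, norm_zero] at hs
    exact zero_ne_one hs
  have hc0 : ((‖χ‖ : ℝ) : ℂ) ≠ 0 := by exact_mod_cast hχ0
  -- Normalizing `χ` makes `s ↦ χ s` isometric, as `norm_apply` shows.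
  refine ⟨m, (‖χ‖ : ℂ)⁻¹ • χ, ?_, fun r => ?_, fun s => ?_⟩
  · rw [norm_smul, norm_inv, Complex.norm_real, norm_norm, inv_mul_cancel₀ hχ0]
  · obtain ⟨s, hs⟩ := e.toLinearEquiv.surjective ⟨_, hmem r⟩
    refine ⟨(‖χ‖ : ℂ) • s, ?_⟩
    rw [map_smul, Representation.IntertwiningMap.smul_apply, smul_inv_smul₀ hc0, hχ]
    exact congrArg Subtype.val hs
  · have h1 : ((‖χ‖ : ℂ)⁻¹ • χ) s ∈ X.toSubmodule := by
      rw [Representation.IntertwiningMap.smul_apply]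
      exact X.toSubmodule.smul_mem _ (e s).2
    exact hX h1

/-- One unit vector `ψ` determines `β = χ⁻¹ T ψ`. It intertwines up to conjugation of `G₀` by `T`,
and this twist cancels in `T φ β⁻¹`, which is therefore an honest intertwiner for every `φ`. -/
theorem exists_transfer (hT : T ∉ S.G₀) (l : Λ) : ∃ (m : Λ) (α : 𝓡.E l ≃ₗᵢ⋆[ℂ] 𝓡.E m)
    (β : R l ≃ₗᵢ⋆[ℂ] R m), ∀ (ψ : 𝓡.E l) (r : R l), S.ρ T (ψ r) = (α ψ) (β r) := by
  have hanti := S.antiunitary_of_notMem T hT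
  have hanti' := S.antiunitary_of_notMem _ (inv_notMem hT)
  obtain ⟨ψ, hψ⟩ := 𝓡.exists_norm_eq_one l
  obtain ⟨m, χ, hχ, hex, hex'⟩ := 𝓡.exists_norm_eq_one_and_image_eq hT hψ
  have hχn : ∀ s, ‖χ s‖ = ‖s‖ := fun s => by rw [𝓡.norm_apply, hχ, one_mul]
  have hψn : ∀ s, ‖ψ s‖ = ‖s‖ := fun s => by rw [𝓡.norm_apply, hψ, one_mul]
  have hχi : Function.Injective χ := (injective_iff_map_eq_zero χ).2 fun s hs => by
    rw [← norm_eq_zero, ← hχn, hs, norm_zero]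
  have hψi : Function.Injective ψ := (injective_iff_map_eq_zero ψ).2 fun s hs => by
    rw [← norm_eq_zero, ← hψn, hs, norm_zero]
  choose b hb using hex
  obtain ⟨β, hβ⟩ := LinearIsometryEquiv.exists_of_antilinear b
    (fun v w => hχi (by rw [map_add, hb, hb, hb, map_add, map_add]))
    (fun z v => hχi (by rw [map_smul, hb, hb, map_smul, hanti.map_smul]))
    (fun v => by rw [← hχn, hb, norm_ρ_apply, hψn])
    (fun s => by
      obtain ⟨r, hr⟩ := hex' s
      exact ⟨r, hχi (by rw [hb, hr])⟩)
  have hχβ : ∀ r, χ (β r) = S.ρ T (ψ r) := fun r => by rw [hβ, hb]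
  have hβσ : ∀ (g : S.G₀) r, β (𝓡.σ l ⟨_, conj_mem hT g.2⟩ r) = 𝓡.σ m g (β r) :=
    fun g r => hχi (by rw [hχβ, apply_rep, apply_rep, hχβ, ρ_conj_apply])
  have hβσ' : ∀ (g : S.G₀) s, β.symm (𝓡.σ m g s) = 𝓡.σ l ⟨_, conj_mem hT g.2⟩ (β.symm s) :=
    fun g s => by rw [β.symm_apply_eq, hβσ, β.apply_symm_apply]
  let a : 𝓡.E l → 𝓡.E m := fun φ =>
    { toFun := fun s => S.ρ T (φ (β.symm s))
      map_add' := fun s s' => by rw [map_add, map_add, map_add]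
      map_smul' := fun z s => by
        rw [map_smulₛₗ, map_smul, hanti.map_smul, Complex.conj_conj]; rfl
      isIntertwining' := fun g => by
        ext s
        change S.ρ T (φ (β.symm (𝓡.σ m g s))) = S.ρ g (S.ρ T (φ (β.symm s)))
        rw [hβσ', apply_rep, ρ_conj_apply] }
  have ha : ∀ φ s, a φ s = S.ρ T (φ (β.symm s)) := fun _ _ => rfl
  obtain ⟨s₀, hs₀⟩ := 𝓡.exists_vector_norm_eq_one m
  obtain ⟨α, hα⟩ := LinearIsometryEquiv.exists_of_antilinear a
    (fun φ φ' => by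
      ext s
      change S.ρ T (φ (β.symm s) + φ' (β.symm s)) = _
      rw [map_add]; rfl)
    (fun z φ => by
      ext s
      change S.ρ T (z • φ (β.symm s)) = _
      rw [hanti.map_smul]; rfl)
    (fun φ => by
      have h := 𝓡.norm_apply (a φ) s₀
      rw [ha, norm_ρ_apply, 𝓡.norm_apply, β.symm.norm_map, hs₀, mul_one, mul_one] at h
      exact h.symm)
    (fun φ => by
      -- The preimage of `φ` under `a` is `T⁻¹ φ β`.
      refine ⟨
        { toFun := fun r => S.ρ T⁻¹ (φ (β r))
          map_add' := fun s s' => by rw [map_add, map_add, map_add]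
          map_smul' := fun z s => by
            rw [map_smulₛₗ, map_smul, hanti'.map_smul, Complex.conj_conj]; rfl
          isIntertwining' := fun g => ?_ }, ?_⟩
      · ext r
        change S.ρ T⁻¹ (φ (β (𝓡.σ l g r))) = S.ρ g (S.ρ T⁻¹ (φ (β r)))
        have h1 := conj_mem (inv_notMem hT) g.2
        have h2 := hβσ ⟨_, h1⟩ r
        have h3 : (⟨_, conj_mem hT h1⟩ : S.G₀) = g := Subtype.ext (by group)
        rw [h3] at h2
        rw [h2, apply_rep, ρ_conj_apply]
      · ext s
        change S.ρ T (S.ρ T⁻¹ (φ (β (β.symm s)))) = φ s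
        rw [ρ_apply_inv_apply, β.apply_symm_apply])
  exact ⟨m, α, β, fun φ r => by rw [hα, ha, β.symm_apply_apply]⟩

omit [FiniteDimensional ℂ V] in
theorem image_sector_of_transfer {l m : Λ} {α : 𝓡.E l ≃ₗᵢ⋆[ℂ] 𝓡.E m} {β : R l ≃ₗᵢ⋆[ℂ] R m}
    (h : ∀ (ψ : 𝓡.E l) (r : R l), S.ρ T (ψ r) = (α ψ) (β r)) :
    S.ρ T '' (𝓡.sector l : Set V) = 𝓡.sector m := by
  refine Set.Subset.antisymm ?_ fun v hv => ?_
  · rintro _ ⟨v, hv, rfl⟩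
    refine 𝓡.sector_induction (p := fun v => S.ρ T v ∈ 𝓡.sector m) (fun ψ r => ?_)
      (fun v w hv hw => by rw [map_add]; exact add_mem hv hw) hv
    rw [h]
    exact 𝓡.apply_mem_sector _ _
  · refine 𝓡.sector_induction (p := fun v => v ∈ S.ρ T '' (𝓡.sector l : Set V)) (fun ψ r => ?_)
      ?_ hv
    · refine ⟨α.symm ψ (β.symm r), 𝓡.apply_mem_sector _ _, ?_⟩
      rw [h, α.apply_symm_apply, β.apply_symm_apply]
    · rintro _ _ ⟨v, hv, rfl⟩ ⟨w, hw, rfl⟩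
      exact ⟨v + w, add_mem hv hw, map_add _ _ _⟩

theorem exists_apply_ne_zero (l : Λ) : ∃ (ψ : 𝓡.E l) (r : R l), ψ r ≠ 0 := by
  obtain ⟨ψ, hψ⟩ := 𝓡.exists_norm_eq_one l
  obtain ⟨r, hr⟩ := 𝓡.exists_vector_norm_eq_one l
  refine ⟨ψ, r, fun h => ?_⟩
  have := 𝓡.norm_apply ψ r
  rw [h, hψ, hr] at this
  simp at this

theorem sector_injective : Function.Injective fun l => (𝓡.sector l : Set V) := fun l m h => by
  obtain ⟨ψ, r, h0⟩ := 𝓡.exists_apply_ne_zero l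
  exact 𝓡.eq_of_apply_mem_sector h0 (h.subset (𝓡.apply_mem_sector ψ r))

theorem exists_isTransfer (hT : T ∉ S.G₀) {l : Λ}
    (h : S.ρ T '' (𝓡.sector l : Set V) = 𝓡.sector l) :
    ∃ (α : 𝓡.E l ≃ₗᵢ⋆[ℂ] 𝓡.E l) (β : R l ≃ₗᵢ⋆[ℂ] R l), 𝓡.IsTransfer T α β := by
  obtain ⟨m, α, β, hαβ⟩ := 𝓡.exists_transfer hT l
  obtain rfl : m = l := 𝓡.sector_injective ((𝓡.image_sector_of_transfer hαβ).symm.trans h)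
  exact ⟨α, β, hαβ⟩

theorem exists_perm (hT : T ∉ S.G₀) : ∃ π : Equiv.Perm Λ,
    (∀ l, S.ρ T '' (𝓡.sector l : Set V) = 𝓡.sector (π l)) ∧ ∀ l, π (π l) = l := by
  choose π α β hαβ using 𝓡.exists_transfer hT
  have him : ∀ l, S.ρ T '' (𝓡.sector l : Set V) = 𝓡.sector (π l) :=
    fun l => 𝓡.image_sector_of_transfer (hαβ l)
  have hinv : Function.Involutive π := fun l => by
    obtain ⟨ψ, r, h0⟩ := 𝓡.exists_apply_ne_zero l
    have h1 : S.ρ T (S.ρ T (ψ r)) ∈ 𝓡.sector (π (π l)) :=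
      (him _).subset ⟨_, (him l).subset ⟨_, 𝓡.apply_mem_sector ψ r, rfl⟩, rfl⟩
    -- As an element of `G₀`, `T²` preserves the image of `ψ`, so this nonzero vector is still in
    -- the sector `l`.
    have h2 : S.ρ T (S.ρ T (ψ r)) = ψ (𝓡.σ l ⟨_, mul_self_mem hT⟩ r) := by
      rw [apply_rep, ρ_mul_apply]
    rw [h2] at h1
    refine (𝓡.eq_of_apply_mem_sector ?_ h1).symm
    rw [← h2, ← norm_ne_zero_iff, norm_ρ_apply, norm_ρ_apply, norm_ne_zero_iff]
    exact h0
  exact ⟨hinv.toPerm, him, hinv⟩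

section Perm

variable {π : Λ → Λ} (him : ∀ l, S.ρ T '' (𝓡.sector l : Set V) = 𝓡.sector (π l))
  (hinv : ∀ l, π (π l) = l)

omit [FiniteDimensional ℂ V] in
include him in
theorem ρ_apply_mem_sector {l : Λ} {v : V} (hv : v ∈ 𝓡.sector l) :
    S.ρ T v ∈ 𝓡.sector (π l) :=
  (him l).subset ⟨v, hv, rfl⟩

theorem mem_compatible_of_sectors (hT : T ∉ S.G₀) {U : UGroup V} (hU : U ∈ S.unitaryCentralizer)
    (h : ∀ l, ∀ v ∈ 𝓡.sector l,
      (U : V →L[ℂ] V) (S.ρ T ((U : V →L[ℂ] V) v)) = S.ρ T v) : U ∈ S.compatible := by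
  refine (mem_compatible_iff hT).2 ⟨hU, fun v => ?_⟩
  let u := ((U : V →L[ℂ] V) : V →ₗ[ℂ] V).toAddMonoidHom
  exact 𝓡.addHom_ext (f := u.comp ((S.ρ T).comp u)) (g := S.ρ T) h v

include him hinv in
-- From `U T U = T`, the action on `T w` is `T U⁻¹ w`; one sector of an exchanged pair determines
-- the other.
theorem isProductOfFactors_of_notMem (hT : T ∉ S.G₀) {Ω : Set Λ} (h₁ : ∀ l, l ∈ Ω ∨ π l ∈ Ω)
    (h₂ : ∀ l ∈ Ω, π l ∈ Ω → π l = l) : 𝓡.IsProductOfFactors Ω := by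
  refine 𝓡.isProductOfFactors Ω (fun U hU W hW h => ?_) fun u hu => ?_
  · refine 𝓡.eq_of_eqOn_sectors fun l v hv => ?_
    by_cases hl : l ∈ Ω
    · exact h l hl v hv
    have hl' := (h₁ l).resolve_left hl
    have hU' := (mem_compatible_iff hT).1 hU
    have hW' := (mem_compatible_iff hT).1 hW
    obtain ⟨w, hw, rfl⟩ : v ∈ S.ρ T '' (𝓡.sector (π l) : Set V) := by
      rw [him, hinv]; exact hv
    have hw' : ((U⁻¹ : UGroup V) : V →L[ℂ] V) w ∈ 𝓡.sector (π l) :=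
      (𝓡.actsAs_component ⟨U, hU'.1⟩ (π l)).inv.apply_mem_sector hw
    have e1 := hU'.2 (((U⁻¹ : UGroup V) : V →L[ℂ] V) w)
    have e2 := hW'.2 (((U⁻¹ : UGroup V) : V →L[ℂ] V) w)
    rw [← h _ hl' _ hw'] at e2
    rw [UGroup.apply_inv_apply] at e1 e2
    rw [e1, e2]
  · classical
    -- `f` picks the representative in `Ω`. Both sectors of a pair receive components of the same
    -- compatible operator `u (f l)`, so the relation between them is inherited.
    let f : Λ → Ω := fun l => if hl : l ∈ Ω then ⟨l, hl⟩ else ⟨π l, (h₁ l).resolve_left hl⟩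
    have hf : ∀ l : Ω, f l = l := fun l => by simp [f]
    have hfπ : ∀ l, f (π l) = f l := fun l => by
      by_cases hl : l ∈ Ω <;> by_cases hl' : π l ∈ Ω
      · simp [f, h₂ l hl hl']
      · simp [f, hl, hl', hinv]
      · simp [f, hl, hl']
      · exact absurd (h₁ l) (by tauto)
    obtain ⟨U, hU, hx⟩ := 𝓡.exists_mem_unitaryCentralizer
      fun l => 𝓡.component ⟨u (f l), (hu _).1⟩ l
    have heq : ∀ l, ∀ v ∈ 𝓡.sector l, (U : V →L[ℂ] V) v = (u (f l) : V →L[ℂ] V) v :=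
      fun l v hv => (hx l).eqOn_sector (𝓡.actsAs_component ⟨u (f l), (hu _).1⟩ l) hv
    refine ⟨U, 𝓡.mem_compatible_of_sectors hT hU fun l v hv => ?_, fun l v hv => ?_⟩
    · have h3 : (u (f l) : V →L[ℂ] V) v ∈ 𝓡.sector l :=
        (𝓡.actsAs_component ⟨u (f l), (hu _).1⟩ l).apply_mem_sector hv
      rw [heq l v hv, heq (π l) _ (𝓡.ρ_apply_mem_sector him h3), hfπ]
      exact ((mem_compatible_iff hT).1 (hu (f l))).2 v
    · rw [heq l v hv, hf]

include him hinv in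
-- Take `W` equal to `x` on the sector `l` and to the identity elsewhere. In `W T W⁻¹ T⁻¹` the inner
-- `W⁻¹` acts on the partner sector, trivially, so the component at `l` is `x`.
theorem factor_eq_univ_of_ne (hT : T ∉ S.G₀) {l : Λ} (hl : π l ≠ l) :
    𝓡.factor l = Set.univ := by
  classical
  refine Set.eq_univ_of_forall fun x => ?_
  obtain ⟨t, ht⟩ := exists_antiunitary hT
  obtain ⟨W, hW, hx⟩ := 𝓡.exists_mem_unitaryCentralizer (Function.update 1 l x)
  refine ⟨_, mul_tau_inv_mem_compatible hT ht hW, ?_⟩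
  have h1 : 𝓡.ActsAs W x := by simpa using hx l
  have h2 : 𝓡.ActsAs W (1 : UGroup (𝓡.E (π l))) := by
    have := hx (π l)
    rwa [Function.update_of_ne hl] at this
  refine h1.congr fun v hv => ?_
  obtain ⟨w, hw, rfl⟩ : v ∈ S.ρ T '' (𝓡.sector (π l) : Set V) := by
    rw [him, hinv]; exact hv
  have h3 : ((W⁻¹ : UGroup V) : V →L[ℂ] V) w = w := by
    have h4 := h2.inv
    rw [inv_one] at h4
    exact h4.eqOn_sector (actsAs_one _) hw
  rw [UGroup.mul_apply, tau_apply, ← ht, t.symm_apply_apply, h3]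

include him hinv in
-- Both sides say `x α x = α`: the left by stripping `β` from `U T U = T`, the right by multiplying
-- out `τ(x) = x⁻¹`. Conversely `x` extends by the identity to the other sectors, where `U T U = T`
-- is trivial.
theorem factor_eq_cartanSet (hT : T ∉ S.G₀) {l : Λ} (hl : π l = l)
    {α : 𝓡.E l ≃ₗᵢ⋆[ℂ] 𝓡.E l} {β : R l ≃ₗᵢ⋆[ℂ] R l} (h : 𝓡.IsTransfer T α β) :
    𝓡.factor l = cartanSet (tau α) := by
  classical
  ext x
  have hiff : x ∈ cartanSet (tau α) ↔
      ∀ χ, (x : 𝓡.E l →L[ℂ] 𝓡.E l) (α ((x : 𝓡.E l →L[ℂ] 𝓡.E l) χ)) = α χ := by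
    refine ⟨fun hx χ => ?_, fun hx => UGroup.ext_apply fun ψ => ?_⟩
    · have h1 : tau α x = x⁻¹ := hx
      have h2 := tau_apply α x (α χ)
      rw [h1, α.symm_apply_apply] at h2
      rw [← h2, UGroup.apply_inv_apply]
    · have h2 := hx (α.symm ψ)
      rw [α.apply_symm_apply] at h2
      rw [tau_apply]
      conv_rhs => rw [← h2]
      rw [UGroup.inv_apply_apply]
  rw [hiff]
  constructor
  · rintro ⟨U, hU, hx⟩ χ
    ext r
    obtain ⟨r, rfl⟩ := β.surjective r
    change ((x : 𝓡.E l →L[ℂ] 𝓡.E l) (α ((x : 𝓡.E l →L[ℂ] 𝓡.E l) χ))) (β r) = α χ (β r)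
    rw [hx, ← h, hx, ← h]
    exact ((mem_compatible_iff hT).1 hU).2 _
  · intro hx
    obtain ⟨W, hW, hWx⟩ := 𝓡.exists_mem_unitaryCentralizer (Function.update 1 l x)
    have h1 : 𝓡.ActsAs W x := by simpa using hWx l
    have h2 : ∀ m, m ≠ l → ∀ v ∈ 𝓡.sector m, (W : V →L[ℂ] V) v = v := fun m hm v hv => by
      have h3 := hWx m
      rw [Function.update_of_ne hm] at h3
      exact h3.eqOn_sector (actsAs_one _) hv
    refine ⟨W, 𝓡.mem_compatible_of_sectors hT hW fun m v hv => ?_, h1⟩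
    by_cases hm : m = l
    · subst hm
      refine 𝓡.sector_induction (p := fun v =>
        (W : V →L[ℂ] V) (S.ρ T ((W : V →L[ℂ] V) v)) = S.ρ T v) (fun ψ r => ?_)
        (fun v w hv hw => by rw [map_add, map_add, map_add, map_add, hv, hw]) hv
      rw [← h1, h, h, ← h1, hx]
    · have hm' : π m ≠ l := fun e => hm (by rw [← hinv m, e, hl])
      rw [h2 m hm v hv, h2 _ hm' _ (𝓡.ρ_apply_mem_sector him hv)]

end Perm

theorem exists_smul_of_isTransfer (hT : T ∉ S.G₀) {l : Λ} {α : 𝓡.E l ≃ₗᵢ⋆[ℂ] 𝓡.E l}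
    {β : R l ≃ₗᵢ⋆[ℂ] R l} (h : 𝓡.IsTransfer T α β) :
    ∃ εα : ℤˣ, ∀ ψ, α (α ψ) = εα • ψ := by
  obtain ⟨s, hs⟩ := 𝓡.exists_vector_norm_eq_one l
  -- With `β² r = s`, evaluating `α² ψ` at `s` gives `T² (ψ r) = ψ (σ(T²) r)`. Pairing with `ψ' s`
  -- exhibits `α²` as multiplication by `c`.
  obtain ⟨r, hr⟩ : ∃ r, β (β r) = s := ⟨β.symm (β.symm s), by simp⟩
  have hss : ⟪s, s⟫_ℂ = 1 := by rw [inner_self_eq_norm_sq_to_K, hs]; simp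
  let c : ℂ := ⟪s, 𝓡.σ l ⟨_, mul_self_mem hT⟩ r⟫_ℂ
  have hc : ∀ ψ, α (α ψ) = c • ψ := fun ψ => by
    refine ext_inner_left ℂ fun ψ' => ?_
    have h1 := 𝓡.inner_apply_apply ψ' (α (α ψ)) s s
    have h2 : α (α ψ) s = ψ (𝓡.σ l ⟨_, mul_self_mem hT⟩ r) := by
      rw [apply_rep, ρ_mul_apply, h, h, hr]
    rw [h2, 𝓡.inner_apply_apply, hss, mul_one] at h1
    rw [← h1, inner_smul_right, mul_comm]
  obtain ⟨ψ, hψ⟩ := 𝓡.occurs l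
  have : Nontrivial (𝓡.E l) := nontrivial_of_ne ψ 0 hψ
  obtain ⟨ε, hε⟩ := exists_intUnit_smul_eq (eq_one_or_eq_neg_one_of_antiunitary_sq α c hc)
  exact ⟨ε, fun ψ => by rw [hc, hε, intCast_units_smul]⟩

theorem exists_signs_of_isTransfer (hT : T ∉ S.G₀) {l : Λ} {α : 𝓡.E l ≃ₗᵢ⋆[ℂ] 𝓡.E l}
    {β : R l ≃ₗᵢ⋆[ℂ] R l} (h : 𝓡.IsTransfer T α β) {εα : ℤˣ} (hα : ∀ ψ, α (α ψ) = εα • ψ)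
    {z : ℂ} (hz : ∀ v, S.ρ T (S.ρ T v) = z • v) :
    ∃ εT εβ : ℤˣ, (∀ v, S.ρ T (S.ρ T v) = εT • v) ∧ (∀ r, β (β r) = εβ • r) ∧
      εα = εT * εβ := by
  obtain ⟨t, ht⟩ := exists_antiunitary hT
  obtain ⟨ψ, s, h0⟩ := 𝓡.exists_apply_ne_zero l
  have : Nontrivial V := nontrivial_of_ne _ _ h0
  obtain ⟨εT, hεT⟩ := exists_intUnit_smul_eq
    (eq_one_or_eq_neg_one_of_antiunitary_sq t z fun v => by rw [ht, ht, hz])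
  have hTT : ∀ v, S.ρ T (S.ρ T v) = εT • v := fun v => by rw [hz, hεT, intCast_units_smul]
  obtain ⟨ψ, hψ⟩ := 𝓡.exists_norm_eq_one l
  have hψi : Function.Injective ψ := (injective_iff_map_eq_zero ψ).2 fun s hs => by
    have h1 := 𝓡.norm_apply ψ s
    rw [hs, hψ, one_mul, norm_zero] at h1
    exact norm_eq_zero.1 h1.symm
  -- `T² = α² ⊗ β²` forces `εβ = εT * εα`, signs being their own inverses.
  refine ⟨εT, εT * εα, hTT, fun r => hψi ?_, ?_⟩
  · have h1 := hTT (ψ r)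
    rw [h, h, hα, ← intCast_units_smul εα ψ, Representation.IntertwiningMap.smul_apply,
      intCast_units_smul] at h1
    rw [← intCast_units_smul, map_smul, intCast_units_smul, mul_comm, mul_smul, ← h1, smul_smul,
      Int.units_mul_self, one_smul]
  · rw [← mul_assoc, Int.units_mul_self, one_mul]

end SectorSystem

/-! ### Normal forms of antiunitary operators -/

section NormalForm

variable {E : Type*} [NormedAddCommGroup E] [InnerProductSpace ℂ E]

/-- Polarization: antilinearity exchanges the two terms containing `Complex.I`. -/
theorem LinearIsometryEquiv.inner_antiunitary (α : E ≃ₗᵢ⋆[ℂ] E) (v w : E) :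
    ⟪α v, α w⟫_ℂ = (starRingEnd ℂ) ⟪v, w⟫_ℂ := by
  have h : ∀ x : E, (Complex.I : ℂ) • α x = - α (Complex.I • x) := fun x => by
    rw [map_smulₛₗ, Complex.conj_I, neg_smul, neg_neg]
  have h1 : α v - (Complex.I : ℂ) • α w = α (v + (Complex.I : ℂ) • w) := by
    rw [h, sub_neg_eq_add, map_add]
  have h2 : α v + (Complex.I : ℂ) • α w = α (v - (Complex.I : ℂ) • w) := by
    rw [h, ← sub_eq_add_neg, map_sub]
  rw [inner_eq_sum_norm_sq_div_four, inner_eq_sum_norm_sq_div_four]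
  rw [RCLike.I_to_complex, h1, h2, ← map_add, ← map_sub, α.norm_map, α.norm_map, α.norm_map,
    α.norm_map]
  simp only [map_div₀, _root_.map_add, _root_.map_sub, map_mul, map_pow, Complex.conj_I,
    RCLike.ofReal_eq_complex_ofReal, Complex.conj_ofReal, map_ofNat]
  ring

theorem Orthonormal.finCons {n : ℕ} {v : Fin n → E} (hv : Orthonormal ℂ v) {u : E}
    (hu : ‖u‖ = 1) (h : ∀ i, ⟪v i, u⟫_ℂ = 0) :
    Orthonormal ℂ (Fin.cons u v : Fin (n + 1) → E) := by
  refine ⟨fun i => ?_, fun i j => ?_⟩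
  · refine Fin.cases ?_ (fun i => ?_) i
    · exact hu
    · exact hv.1 i
  · refine Fin.cases ?_ (fun i => ?_) i <;> refine Fin.cases ?_ (fun j => ?_) j <;> intro hij
    · exact absurd rfl hij
    · exact inner_eq_zero_symm.1 (h j)
    · exact h i
    · exact hv.2 fun h => hij (congrArg Fin.succ h)

theorem Orthonormal.sumElim {ι : Type*} {v w : ι → E} (hv : Orthonormal ℂ v)
    (hw : Orthonormal ℂ w) (h : ∀ i j, ⟪v i, w j⟫_ℂ = 0) : Orthonormal ℂ (Sum.elim v w) := by
  refine ⟨?_, ?_⟩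
  · rintro (i | i)
    · exact hv.1 i
    · exact hw.1 i
  · rintro (i | i) (j | j) hij
    · exact hv.2 fun h => hij (congrArg Sum.inl h)
    · exact h i j
    · exact inner_eq_zero_symm.1 (h j i)
    · exact hw.2 fun h => hij (congrArg Sum.inr h)

theorem Orthonormal.comp_antiunitary {ι : Type*} {v : ι → E} (hv : Orthonormal ℂ v)
    (α : E ≃ₗᵢ⋆[ℂ] E) : Orthonormal ℂ fun i => α (v i) :=
  ⟨fun i => by rw [α.norm_map, hv.1], fun i j hij => by
    change ⟪α (v i), α (v j)⟫_ℂ = 0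
    rw [α.inner_antiunitary, hv.2 hij, map_zero]⟩

/-- A finite orthonormal family is a basis, unless some nonzero vector is orthogonal to it. -/
theorem OrthonormalBasis.exists_or_exists_ne_zero {ι : Type*} [Fintype ι] {v : ι → E}
    (hv : Orthonormal ℂ v) : (∃ b : OrthonormalBasis ι ℂ E, ⇑b = v) ∨
      ∃ w ≠ 0, ∀ i, ⟪v i, w⟫_ℂ = 0 := by
  by_cases h : (Submodule.span ℂ (Set.range v))ᗮ = ⊥
  · exact Or.inl ⟨OrthonormalBasis.mkOfOrthogonalEqBot hv h,
      OrthonormalBasis.coe_of_orthogonal_eq_bot_mk hv h⟩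
  · obtain ⟨w, hw, h0⟩ := Submodule.exists_mem_ne_zero_of_ne_bot h
    exact Or.inr ⟨w, h0, fun i =>
      (Submodule.mem_orthogonal _ _).1 hw _ (Submodule.subset_span ⟨i, rfl⟩)⟩

variable [FiniteDimensional ℂ E]

/-- Lengthen an orthonormal family of fixed vectors as far as possible. A vector `w ≠ 0` orthogonal
to it yields the fixed vector `w + α w`, or `Complex.I • w` if that sum vanishes; the norm is real,
so normalizing keeps it fixed. -/
theorem exists_orthonormalBasis_real (α : E ≃ₗᵢ⋆[ℂ] E) (hα : ∀ v, α (α v) = v) :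
    ∃ b : OrthonormalBasis (Fin (Module.finrank ℂ E)) ℂ E, ∀ i, α (b i) = b i := by
  obtain ⟨n, ⟨v, hv, hαv⟩, hmax⟩ := exists_and_not_succ_of_bounded
    (P := fun n => ∃ v : Fin n → E, Orthonormal ℂ v ∧ ∀ i, α (v i) = v i)
    ⟨Fin.elim0, ⟨fun i => i.elim0, fun i => i.elim0⟩, fun i => i.elim0⟩ (Module.finrank ℂ E)
    (fun n ⟨v, hv, _⟩ => by simpa using hv.linearIndependent.fintype_card_le_finrank)
  rcases OrthonormalBasis.exists_or_exists_ne_zero hv with ⟨b, rfl⟩ | ⟨w, hw0, hw⟩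
  · obtain rfl : n = Module.finrank ℂ E := by
      simpa using (Module.finrank_eq_card_basis b.toBasis).symm
    exact ⟨b, hαv⟩
  · exfalso
    have hαw : ∀ i, ⟪v i, α w⟫_ℂ = 0 := fun i => by
      rw [← hαv i, α.inner_antiunitary, hw, map_zero]
    obtain ⟨u, hu0, hu, hαu⟩ : ∃ u ≠ 0, (∀ i, ⟪v i, u⟫_ℂ = 0) ∧ α u = u := by
      by_cases h : w + α w = 0
      · refine ⟨Complex.I • w, smul_ne_zero Complex.I_ne_zero hw0, fun i => ?_, ?_⟩
        · rw [inner_smul_right, hw, mul_zero]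
        · rw [map_smulₛₗ, ← neg_eq_of_add_eq_zero_right h, Complex.conj_I, neg_smul, smul_neg,
            neg_neg]
      · refine ⟨w + α w, h, fun i => ?_, ?_⟩
        · rw [inner_add_right, hw, hαw, add_zero]
        · rw [map_add, hα, add_comm]
    refine hmax ⟨Fin.cons ((‖u‖ : ℂ)⁻¹ • u) v,
      hv.finCons ?_ (fun i => by rw [inner_smul_right, hu, mul_zero]), fun i => ?_⟩
    · rw [norm_smul, norm_inv, Complex.norm_real, norm_norm, inv_mul_cancel₀ (norm_ne_zero_iff.2 hu0)]
    · refine Fin.cases ?_ (fun i => ?_) i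
      · change α ((‖u‖ : ℂ)⁻¹ • u) = (‖u‖ : ℂ)⁻¹ • u
        rw [map_smulₛₗ, hαu, map_inv₀, Complex.conj_ofReal]
      · exact hαv i

/-- Kramers degeneracy: `α² = -1` gives `⟪u, α u⟫ = -⟪u, α u⟫`, so `u ⟂ α u`. Orthonormal pairs `u,
α u` can thus be split off until they exhaust the space. -/
theorem exists_orthonormalBasis_quaternionic (α : E ≃ₗᵢ⋆[ℂ] E) (hα : ∀ v, α (α v) = -v) :
    ∃ (n : ℕ) (b : OrthonormalBasis (Fin n ⊕ Fin n) ℂ E), Module.finrank ℂ E = 2 * n ∧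
      (∀ i, α (b (Sum.inl i)) = b (Sum.inr i)) ∧ ∀ i, α (b (Sum.inr i)) = -b (Sum.inl i) := by
  obtain ⟨n, ⟨v, hv, hαv⟩, hmax⟩ := exists_and_not_succ_of_bounded
    (P := fun n => ∃ v : Fin n → E, Orthonormal ℂ v ∧ ∀ i j, ⟪v i, α (v j)⟫_ℂ = 0)
    ⟨Fin.elim0, ⟨fun i => i.elim0, fun i => i.elim0⟩, fun i => i.elim0⟩ (Module.finrank ℂ E)
    (fun n ⟨v, hv, _⟩ => by simpa using hv.linearIndependent.fintype_card_le_finrank)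
  have hsum := hv.sumElim (hv.comp_antiunitary α) hαv
  rcases OrthonormalBasis.exists_or_exists_ne_zero hsum with ⟨b, hb⟩ | ⟨w, hw0, hw⟩
  · refine ⟨n, b, ?_, fun i => ?_, fun i => ?_⟩
    · rw [Module.finrank_eq_card_basis b.toBasis]
      simp [two_mul]
    · rw [hb]; rfl
    · rw [hb]; exact hα _
  · exfalso
    have hvw : ∀ i, ⟪v i, w⟫_ℂ = 0 := fun i => hw (Sum.inl i)
    have hαvw : ∀ i, ⟪α (v i), w⟫_ℂ = 0 := fun i => hw (Sum.inr i)
    let u : E := (‖w‖ : ℂ)⁻¹ • w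
    have hu1 : ‖u‖ = 1 := by
      rw [norm_smul, norm_inv, Complex.norm_real, norm_norm,
        inv_mul_cancel₀ (norm_ne_zero_iff.2 hw0)]
    have hvu : ∀ i, ⟪v i, u⟫_ℂ = 0 := fun i => by rw [inner_smul_right, hvw, mul_zero]
    have hαvu : ∀ i, ⟪α (v i), u⟫_ℂ = 0 := fun i => by rw [inner_smul_right, hαvw, mul_zero]
    have hvαu : ∀ i, ⟪v i, α u⟫_ℂ = 0 := fun i => by
      have h := α.inner_antiunitary (α (v i)) u
      rwa [hα, hαvu, map_zero, inner_neg_left, neg_eq_zero] at h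
    have huu : ⟪u, α u⟫_ℂ = 0 := by
      have h := α.inner_antiunitary (α u) u
      rw [hα, inner_conj_symm, inner_neg_left] at h
      exact self_eq_neg.1 h.symm
    refine hmax ⟨Fin.cons u v, hv.finCons hu1 hvu, fun i j => ?_⟩
    refine Fin.cases ?_ (fun i => ?_) i <;> refine Fin.cases ?_ (fun j => ?_) j
    · exact huu
    · exact inner_eq_zero_symm.1 (hαvu j)
    · exact hvαu i
    · exact hαv i j

/-- Antiunitary operators with the same square `±1` are conjugate. -/
theorem exists_conj_of_antiunitary_sq_eq {ε : ℤˣ} {α α' : E ≃ₗᵢ⋆[ℂ] E}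
    (hα : ∀ v, α (α v) = ε • v) (hα' : ∀ v, α' (α' v) = ε • v) :
    ∃ u : UGroup E, ∀ v, (u : E →L[ℂ] E) (α v) = α' ((u : E →L[ℂ] E) v) := by
  -- Two antilinear maps that agree on a basis are equal, so the unitary matching two normal-form
  -- bases conjugates `α` to `α'`.
  have key : ∀ {ι : Type} [Fintype ι] (b b' : OrthonormalBasis ι ℂ E),
      (∀ i, (b.equiv b' (Equiv.refl ι)) (α (b i)) = α' (b' i)) →
        ∃ u : UGroup E, ∀ v, (u : E →L[ℂ] E) (α v) = α' ((u : E →L[ℂ] E) v) := by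
    intro ι _ b b' h
    let w := b.equiv b' (Equiv.refl ι)
    refine ⟨Unitary.linearIsometryEquiv.symm w, fun v => ?_⟩
    have hlin : ((α.toLinearEquiv.trans w.toLinearEquiv : E ≃ₗ⋆[ℂ] E) : E →ₗ⋆[ℂ] E) =
        ((w.toLinearEquiv.trans α'.toLinearEquiv : E ≃ₗ⋆[ℂ] E) : E →ₗ⋆[ℂ] E) := by
      refine b.toBasis.ext fun i => ?_
      rw [b.coe_toBasis]
      change w (α (b i)) = α' (w (b i))
      have hw : w (b i) = b' i := by simp [w]
      rw [hw]
      exact h i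
    exact LinearMap.congr_fun hlin v
  rcases Int.units_eq_one_or ε with rfl | rfl
  · simp only [one_smul] at hα hα'
    obtain ⟨b, hb⟩ := exists_orthonormalBasis_real α hα
    obtain ⟨b', hb'⟩ := exists_orthonormalBasis_real α' hα'
    exact key b b' fun i => by rw [hb, hb']; simp
  · simp only [Units.neg_smul, one_smul] at hα hα'
    obtain ⟨n, b, hn, hl, hr⟩ := exists_orthonormalBasis_quaternionic α hα
    obtain ⟨n', b', hn', hl', hr'⟩ := exists_orthonormalBasis_quaternionic α' hα'
    obtain rfl : n = n' := by omega
    refine key b b' ?_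
    rintro (i | i)
    · rw [hl, hl']; simp
    · rw [hr, hr']; simp

end NormalForm

/-! ### Comparison with matrix groups -/

section MatrixModel

variable {E : Type*} [NormedAddCommGroup E] [InnerProductSpace ℂ E] [FiniteDimensional ℂ E]
  {ι : Type*} [Fintype ι] [DecidableEq ι]

omit [DecidableEq ι] in
theorem UGroup.ext_inner (b : OrthonormalBasis ι ℂ E) {u w : UGroup E}
    (h : ∀ i j, ⟪b i, (u : E →L[ℂ] E) (b j)⟫_ℂ = ⟪b i, (w : E →L[ℂ] E) (b j)⟫_ℂ) : u = w := by
  refine Subtype.ext (ContinuousLinearMap.coe_injective (b.toBasis.ext fun j => ?_))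
  rw [b.coe_toBasis]
  exact InnerProductSpace.ext_inner_left_basis b.toBasis fun i => by rw [b.coe_toBasis]; exact h i j

/-- The matrix of a unitary operator in an orthonormal basis. -/
theorem exists_matrixIso (b : OrthonormalBasis ι ℂ E) :
    ∃ c : UGroup E ≃ₜ* Matrix.unitaryGroup ι ℂ, ∀ (u : UGroup E) (i j : ι),
      (c u : Matrix ι ι ℂ) i j = ⟪b i, (u : E →L[ℂ] E) (b j)⟫_ℂ := by
  let s : (E →ₗ[ℂ] E) ≃⋆ₐ[ℂ] (E →L[ℂ] E) :=
    { LinearMap.toContinuousLinearMap with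
      map_mul' := fun _ _ => rfl
      map_star' := LinearMap.adjoint_toContinuousLinearMap }
  let e := s.symm.trans (LinearMap.toMatrixOrthonormal b)
  let c : UGroup E ≃* Matrix.unitaryGroup ι ℂ :=
    (Unitary.mapEquiv { MulEquivClass.toMulEquiv e with map_star' := map_star e }).toMulEquiv
  have happ : ∀ (u : UGroup E) (i j : ι),
      (c u : Matrix ι ι ℂ) i j = ⟪b i, (u : E →L[ℂ] E) (b j)⟫_ℂ := fun u i j =>
    LinearMap.toMatrixOrthonormal_apply_apply b _ i j
  have hc : Continuous c := by
    rw [Topology.IsInducing.subtypeVal.continuous_iff]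
    refine continuous_matrix fun i j => ?_
    simp only [Function.comp_apply, happ]
    exact continuous_const.inner (UGroup.continuous_apply (b j))
  exact ⟨{ c with
    continuous_toFun := hc
    continuous_invFun := (hc.homeoOfEquivCompactToT2 (f := c.toEquiv)).symm.continuous }, happ⟩

theorem exists_isMatrixIso : ∃ c : UGroup E ≃ₜ*
    Matrix.unitaryGroup (Fin (Module.finrank ℂ E)) ℂ, IsMatrixIso c := by
  obtain ⟨c, hc⟩ := exists_matrixIso (stdOrthonormalBasis ℂ E)
  exact ⟨c, _, hc⟩

theorem isCosetModel_of_basis {K : Subgroup (UGroup E)} {L : Subgroup (Matrix.unitaryGroup ι ℂ)}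
    (b : OrthonormalBasis ι ℂ E)
    (h : ∀ (u : UGroup E) (M : Matrix.unitaryGroup ι ℂ),
      (∀ i j, (M : Matrix ι ι ℂ) i j = ⟪b i, (u : E →L[ℂ] E) (b j)⟫_ℂ) → (u ∈ K ↔ M ∈ L)) :
    IsCosetModel K L := by
  obtain ⟨c, hc⟩ := exists_matrixIso b
  have hKL : ∀ u, u ∈ K ↔ c u ∈ L := fun u => h u (c u) (hc u)
  have hrel : ∀ u w : UGroup E, QuotientGroup.leftRel K u w ↔
      QuotientGroup.leftRel L (c u) (c w) := fun u w => by
    rw [QuotientGroup.leftRel_apply, QuotientGroup.leftRel_apply, hKL, map_mul, map_inv]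
  let q : (UGroup E ⧸ K) ≃ (Matrix.unitaryGroup ι ℂ ⧸ L) := Quotient.congr c.toEquiv hrel
  refine ⟨c, ⟨b, hc⟩, hKL, ⟨q, ?_, ?_⟩, fun u => rfl⟩
  · exact continuous_quot_lift _ (continuous_quot_mk.comp c.continuous_toFun)
  · exact continuous_quot_lift _ (continuous_quot_mk.comp c.continuous_invFun)

omit [DecidableEq ι] in
-- Entrywise form of `τ(u) = u`; in a normal-form basis it becomes reality of the matrix or the
-- symplectic condition.
theorem mem_fixedSubgroup_iff (b : OrthonormalBasis ι ℂ E) (α : E ≃ₗᵢ⋆[ℂ] E) (u : UGroup E) :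
    u ∈ fixedSubgroup (tau α) ↔ ∀ i j, (starRingEnd ℂ) ⟪b i, (u : E →L[ℂ] E) (b j)⟫_ℂ =
      ⟪α (b i), (u : E →L[ℂ] E) (α (b j))⟫_ℂ := by
  have h1 : ∀ i j, ⟪α (b i), ((tau α u : UGroup E) : E →L[ℂ] E) (α (b j))⟫_ℂ =
      (starRingEnd ℂ) ⟪b i, (u : E →L[ℂ] E) (b j)⟫_ℂ := fun i j => by
    rw [tau_apply, α.symm_apply_apply, α.inner_antiunitary]
  refine ⟨fun h i j => ?_, fun h => ?_⟩
  · rw [← h1, show tau α u = u from h]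
  · have h2 : tau α.symm u = u := UGroup.ext_inner b fun i j => by
      have h3 := α.inner_antiunitary (b i) (((tau α.symm u : UGroup E) : E →L[ℂ] E) (b j))
      rw [tau_apply, α.apply_symm_apply] at h3
      have h4 := (h i j).trans h3
      exact ((starRingEnd ℂ).injective h4).symm
    refine UGroup.ext_apply fun v => ?_
    rw [tau_apply]
    conv_lhs => rw [← h2]
    rw [tau_apply, α.apply_symm_apply]
    exact congrArg _ (α.apply_symm_apply v)

theorem isCosetModel_orthogonal (α : E ≃ₗᵢ⋆[ℂ] E) (hα : ∀ v, α (α v) = v) :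
    IsCosetModel (fixedSubgroup (tau α))
      (orthogonalSubgroup (Fin (Module.finrank ℂ E))) := by
  obtain ⟨b, hb⟩ := exists_orthonormalBasis_real α hα
  refine isCosetModel_of_basis b fun u M hM => ?_
  rw [mem_fixedSubgroup_iff b]
  simp only [hb, ← hM]
  constructor
  · intro h
    have hre : M.1 = (M.1.map Complex.re).map
        (fun t : ℝ => (t : ℂ)) := by
      ext i j
      exact (Complex.conj_eq_iff_re.1 (h i j)).symm
    refine ⟨M.1.map Complex.re, ?_, hre⟩
    rw [Matrix.mem_orthogonalGroup_iff]
    have h1 := Matrix.mem_unitaryGroup_iff.1 M.2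
    refine Matrix.map_injective Complex.ofReal_injective ?_
    have h2 : (M.1.map Complex.re * star (M.1.map Complex.re)).map
        (fun t : ℝ => (t : ℂ)) = M.1 * star M.1 := by
      conv_rhs => rw [hre]
      ext i j
      simp [Matrix.mul_apply]
    change (M.1.map Complex.re * star (M.1.map Complex.re)).map
        (fun t : ℝ => (t : ℂ)) = _
    rw [h2, h1]
    ext i j
    by_cases hij : i = j
    · subst hij; simp
    · simp [hij]
  · rintro ⟨o, -, ho⟩ i j
    rw [ho]
    simp

/-- For unitary `M` the entrywise conjugate inverts the transpose, so the transpose in `M J Mᵀ = J`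
can be moved across. -/
theorem mem_symplecticGroup_iff_of_unitary (M : Matrix.unitaryGroup (ι ⊕ ι) ℂ) :
    (M : Matrix (ι ⊕ ι) (ι ⊕ ι) ℂ) ∈ Matrix.symplecticGroup ι ℂ ↔
      (M : Matrix (ι ⊕ ι) (ι ⊕ ι) ℂ) * Matrix.J ι ℂ =
        Matrix.J ι ℂ * (M : Matrix (ι ⊕ ι) (ι ⊕ ι) ℂ).map (starRingEnd ℂ) := by
  have h1 : (M : Matrix (ι ⊕ ι) (ι ⊕ ι) ℂ).transpose *
      (M : Matrix (ι ⊕ ι) (ι ⊕ ι) ℂ).map (starRingEnd ℂ) = 1 := by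
    have h := congrArg Matrix.transpose (Matrix.mem_unitaryGroup_iff'.1 M.2)
    rw [Matrix.transpose_mul, Matrix.transpose_one] at h
    exact h
  have h2 := mul_eq_one_comm.1 h1
  rw [SymplecticGroup.mem_iff]
  constructor
  · intro h
    conv_rhs => rw [← h]
    rw [mul_assoc, h1, mul_one]
  · intro h
    rw [h, mul_assoc, h2, mul_one]

theorem isCosetModel_symplectic {n : ℕ} (α : E ≃ₗᵢ⋆[ℂ] E)
    (b : OrthonormalBasis (Fin n ⊕ Fin n) ℂ E) (hl : ∀ i, α (b (Sum.inl i)) = b (Sum.inr i))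
    (hr : ∀ i, α (b (Sum.inr i)) = -b (Sum.inl i)) :
    IsCosetModel (fixedSubgroup (tau α)) (unitarySymplecticSubgroup (Fin n)) := by
  refine isCosetModel_of_basis b fun u M hM => ?_
  rw [mem_fixedSubgroup_iff b]
  refine Iff.trans ?_ (mem_symplecticGroup_iff_of_unitary M).symm
  set N : Matrix (Fin n ⊕ Fin n) (Fin n ⊕ Fin n) ℂ := M.1
  rw [← Matrix.ext_iff]
  have hJ : ∀ A : Matrix (Fin n ⊕ Fin n) (Fin n ⊕ Fin n) ℂ, ∀ i k,
      (A * Matrix.J (Fin n) ℂ) i (Sum.inl k) = A i (Sum.inr k) ∧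
      (A * Matrix.J (Fin n) ℂ) i (Sum.inr k) = -A i (Sum.inl k) ∧
      (Matrix.J (Fin n) ℂ * A) (Sum.inl k) i = -A (Sum.inr k) i ∧
      (Matrix.J (Fin n) ℂ * A) (Sum.inr k) i = A (Sum.inl k) i := by
    intro A i k
    refine ⟨?_, ?_, ?_, ?_⟩ <;>
      simp [Matrix.mul_apply, Matrix.J, Fintype.sum_sum_type, Matrix.one_apply]
  simp only [Sum.forall, hl, hr, map_neg, inner_neg_left, inner_neg_right, neg_neg, ← hM,
    fun A i k => (hJ A i k).1, fun A i k => (hJ A i k).2.1, fun A i k => (hJ A i k).2.2.1,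
    fun A i k => (hJ A i k).2.2.2, Matrix.map_apply]
  constructor
  · rintro ⟨h1, h2⟩
    exact ⟨fun i => ⟨fun j => by rw [(h2 i).1 j, neg_neg], fun j => by rw [(h2 i).2 j]⟩,
      fun i => ⟨fun j => ((h1 i).1 j).symm, fun j => ((h1 i).2 j).symm⟩⟩
  · rintro ⟨h1, h2⟩
    exact ⟨fun i => ⟨fun j => ((h2 i).1 j).symm, fun j => ((h2 i).2 j).symm⟩,
      fun i => ⟨fun j => by rw [(h1 i).1 j, neg_neg], fun j => neg_injective ((h1 i).2 j).symm⟩⟩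

end MatrixModel

/-! ### An analytic square root near the identity -/

/-- Inverse function theorem for `a ↦ a * a`, whose derivative at `1` is multiplication by `2`. The
local injectivity in the last clause later identifies roots with equal squares. -/
theorem exists_analyticAt_sqrt (A : Type*) [NormedRing A] [NormedAlgebra ℝ A] [CompleteSpace A] :
    ∃ s : A → A, AnalyticAt ℝ s 1 ∧ s 1 = 1 ∧ (∀ᶠ y in nhds 1, s y * s y = y) ∧
      ∃ N ∈ nhds (1 : A), ∀ a ∈ N, ∀ b ∈ N, a * a = b * b → a = b := by
  let i : A ≃L[ℝ] A := ContinuousLinearEquiv.smulLeft (Units.mk0 (2 : ℝ) two_ne_zero)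
  have hf : HasStrictFDerivAt (fun a : A => a * a) (i : A →L[ℝ] A) 1 := by
    have h := (hasStrictFDerivAt_id (𝕜 := ℝ) (1 : A)).mul' (hasStrictFDerivAt_id (𝕜 := ℝ) (1 : A))
    refine h.congr_fderiv ?_
    ext a
    simp [i, two_smul]
  let e := hf.toOpenPartialHomeomorph (fun a : A => a * a)
  have hsrc : (1 : A) ∈ e.source := hf.mem_toOpenPartialHomeomorph_source
  have he : ∀ a, e a = a * a := fun a => rfl
  have h1 : e 1 = 1 := by rw [he, one_mul]
  have hana : AnalyticAt ℝ e 1 := (analyticAt_id (𝕜 := ℝ) (z := (1 : A))).mul analyticAt_id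
  refine ⟨e.symm, ?_, ?_, ?_, e.source, e.open_source.mem_nhds hsrc, fun a ha b hb h =>
    e.injOn ha hb h⟩
  · have h2 := e.analyticAt_symm' hsrc hana hf.hasFDerivAt.fderiv
    rwa [h1] at h2
  · conv_lhs => rw [← h1]
    exact e.left_inv hsrc
  · have htgt : (1 : A) ∈ e.target := h1 ▸ e.map_source hsrc
    filter_upwards [e.open_target.mem_nhds htgt] with y hy
    exact e.right_inv hy

/-! ### The Cartan embedding -/

section CartanEmbedding

variable {E : Type*} [NormedAddCommGroup E] [InnerProductSpace ℂ E] [FiniteDimensional ℂ E]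

/-- Conjugation by an antiunitary operator, as a real-linear map on all endomorphisms. -/
noncomputable def tauLinear (α : E ≃ₗᵢ⋆[ℂ] E) : (E →L[ℂ] E) →L[ℝ] (E →L[ℂ] E) :=
  LinearMap.mkContinuous
    { toFun := fun a => (α.toContinuousLinearEquiv : E →SL[starRingEnd ℂ] E).comp
        (a.comp (α.symm.toContinuousLinearEquiv : E →SL[starRingEnd ℂ] E))
      map_add' := fun a b => by ext v; simp
      map_smul' := fun t a => by
        ext v
        change α (((t : ℂ) • a) (α.symm v)) = (t : ℂ) • α (a (α.symm v))
        rw [smul_apply, map_smulₛₗ, Complex.conj_ofReal] } 1 fun a => by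
    rw [one_mul]
    refine ContinuousLinearMap.opNorm_le_bound _ (norm_nonneg a) fun v => ?_
    change ‖α (a (α.symm v))‖ ≤ _
    rw [α.norm_map, ← α.symm.norm_map v]
    exact a.le_opNorm _

omit [FiniteDimensional ℂ E] in
theorem tauLinear_apply (α : E ≃ₗᵢ⋆[ℂ] E) (a : E →L[ℂ] E) (v : E) :
    tauLinear α a v = α (a (α.symm v)) := rfl

omit [FiniteDimensional ℂ E] in
theorem tauLinear_mul (α : E ≃ₗᵢ⋆[ℂ] E) (a b : E →L[ℂ] E) :
    tauLinear α (a * b) = tauLinear α a * tauLinear α b := by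
  ext v
  simp [tauLinear_apply]

theorem continuous_tau (α : E ≃ₗᵢ⋆[ℂ] E) : Continuous (tau α) :=
  UGroup.continuous_iff.2 fun _ => α.continuous.comp (UGroup.continuous_apply _)

theorem tau_tau {α : E ≃ₗᵢ⋆[ℂ] E} {ε : ℤˣ} (hα : ∀ v, α (α v) = ε • v) (u : UGroup E) :
    tau α (tau α u) = u := by
  refine UGroup.ext_apply fun v => ?_
  obtain ⟨w, rfl⟩ : ∃ w, α (α w) = v := ⟨α.symm (α.symm v), by simp⟩
  rw [tau_apply, tau_apply, α.symm_apply_apply, α.symm_apply_apply, hα, hα,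
    ← intCast_units_smul, ← intCast_units_smul, map_smul]

theorem analyticAt_star (a : E →L[ℂ] E) : AnalyticAt ℝ (fun a : E →L[ℂ] E => star a) a :=
  ((starL' ℝ : (E →L[ℂ] E) ≃L[ℝ] (E →L[ℂ] E)) : (E →L[ℂ] E) →L[ℝ] (E →L[ℂ] E)).analyticAt a

variable {α : E ≃ₗᵢ⋆[ℂ] E}

/-- The map `u ↦ u τ(u⁻¹)` into `{x | τ(x) = x⁻¹}`. -/
noncomputable def cartanMap (hτ : ∀ u, tau α (tau α u) = u) (u : UGroup E) :
    cartanSet (tau α) :=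
  ⟨u * tau α u⁻¹, by
    change tau α (u * tau α u⁻¹) = (u * tau α u⁻¹)⁻¹
    rw [map_mul, hτ, mul_inv_rev, map_inv, inv_inv]⟩

theorem cartanMap_eq_iff (hτ : ∀ u, tau α (tau α u) = u) (u w : UGroup E) :
    cartanMap hτ u = cartanMap hτ w ↔ u⁻¹ * w ∈ fixedSubgroup (tau α) := by
  rw [Subtype.ext_iff]
  change u * tau α u⁻¹ = w * tau α w⁻¹ ↔ tau α (u⁻¹ * w) = u⁻¹ * w
  rw [map_mul, map_inv, map_inv, eq_inv_mul_iff_mul_eq, ← mul_assoc, eq_mul_inv_iff_mul_eq]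

theorem continuous_cartanMap (hτ : ∀ u, tau α (tau α u) = u) : Continuous (cartanMap hτ) :=
  (continuous_id.mul ((continuous_tau α).comp continuous_inv)).subtype_mk _

/-- `(x α)² = x τ(x) α² = α²`, so some unitary `u` satisfies `u α = x α u`, and `x = u τ(u⁻¹)`. -/
theorem surjective_cartanMap {ε : ℤˣ} (hα : ∀ v, α (α v) = ε • v) :
    Function.Surjective (cartanMap (tau_tau hα)) := by
  rintro ⟨x, hx⟩
  let α' : E ≃ₗᵢ⋆[ℂ] E := α.trans (Unitary.linearIsometryEquiv x)
  have hα'a : ∀ v, α' v = (x : E →L[ℂ] E) (α v) := fun v => rfl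
  have hα' : ∀ v, α' (α' v) = ε • v := fun v => by
    have h1 : tau α x = x⁻¹ := hx
    have h2 := tau_apply α x (α (α v))
    rw [h1, α.symm_apply_apply] at h2
    rw [hα'a, hα'a, ← h2, UGroup.apply_inv_apply, hα]
  obtain ⟨u, hu⟩ := exists_conj_of_antiunitary_sq_eq hα hα'
  refine ⟨u, Subtype.ext (UGroup.ext_apply fun v => ?_)⟩
  change ((u * tau α u⁻¹ : UGroup E) : E →L[ℂ] E) v = (x : E →L[ℂ] E) v
  rw [UGroup.mul_apply, tau_apply, hu, UGroup.apply_inv_apply, hα'a, α.apply_symm_apply]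

/-- Near any of its values, the Cartan map has a section that extends to an analytic map. -/
theorem exists_analytic_section (hτ : ∀ u, tau α (tau α u) = u) (u : UGroup E) :
    ∃ s : (E →L[ℂ] E) → (E →L[ℂ] E), AnalyticAt ℝ s (cartanMap hτ u : UGroup E) ∧
      s (cartanMap hτ u : UGroup E) = u ∧
      ∀ᶠ x : cartanSet (tau α) in nhds (cartanMap hτ u), ∃ w : UGroup E, (w : E →L[ℂ] E) = s (x : UGroup E) ∧
        cartanMap hτ w = x := by
  obtain ⟨q, hqa, hq1, hqq, N, hN, hNinj⟩ := exists_analyticAt_sqrt (E →L[ℂ] E)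
  -- Translation to the identity: `Y` sends the base point to `1`. The section will be `u` times the
  -- square root of `Y x`.
  let Y : UGroup E → UGroup E := fun x => u⁻¹ * x * tau α u
  let y : (E →L[ℂ] E) → (E →L[ℂ] E) := fun a => star (u : E →L[ℂ] E) * a * tauLinear α u
  have hYy : ∀ x : UGroup E, (Y x : E →L[ℂ] E) = y x := fun x => rfl
  have hy1 : y (cartanMap hτ u : UGroup E) = 1 := by
    rw [← hYy]
    have : Y (cartanMap hτ u) = 1 := by
      change u⁻¹ * (u * tau α u⁻¹) * tau α u = 1
      rw [inv_mul_cancel_left, map_inv, inv_mul_cancel]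
    rw [this]; rfl
  have hya : AnalyticAt ℝ y (cartanMap hτ u : UGroup E) :=
    (analyticAt_const.mul analyticAt_id).mul analyticAt_const
  have hqa' : AnalyticAt ℝ q (y (cartanMap hτ u : UGroup E)) := by rwa [hy1]
  refine ⟨fun a => u * q (y a), analyticAt_const.mul (hqa'.comp hya), ?_, ?_⟩
  · change (u : E →L[ℂ] E) * q (y _) = u
    rw [hy1, hq1, mul_one]
  have hqc : Filter.Tendsto q (nhds 1) (nhds 1) := by
    have h := hqa.continuousAt.tendsto
    rwa [hq1] at h
  have hstar : Filter.Tendsto (fun a : E →L[ℂ] E => star a) (nhds 1) (nhds 1) := by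
    have h := (continuous_star (R := E →L[ℂ] E)).tendsto 1
    rwa [star_one] at h
  have htau : Filter.Tendsto (tauLinear α) (nhds 1) (nhds 1) := by
    have h := (tauLinear α).continuous.tendsto 1
    have h1 : tauLinear α 1 = 1 := by ext v; simp [tauLinear_apply]
    rwa [h1] at h
  have hlim : Filter.Tendsto (fun x : cartanSet (tau α) => y (x : UGroup E))
      (nhds (cartanMap hτ u)) (nhds 1) := by
    rw [← hy1]
    have hc : Continuous fun x : cartanSet (tau α) => y (x : UGroup E) :=
      (continuous_const.mul (continuous_subtype_val.comp continuous_subtype_val)).mul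
        continuous_const
    exact hc.tendsto _
  have hmul : Filter.Tendsto (fun a => q a * star a) (nhds 1) (nhds 1) := by
    have h := hqc.mul hstar
    rwa [one_mul] at h
  filter_upwards [hlim.eventually hqq, hlim.eventually ((hstar.comp hqc).eventually hN),
    hlim.eventually ((htau.comp hqc).eventually hN), hlim.eventually (hmul.eventually hN)]
    with x h1 h2 h3 h4
  set p := q (y (x : UGroup E))
  have hx : tau α (x : UGroup E) = (x : UGroup E)⁻¹ := x.2
  have hτY : tau α (Y x) = (Y x)⁻¹ := by
    simp only [Y, map_mul, hx, hτ, map_inv, mul_inv_rev, inv_inv, mul_assoc]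
  have hu1 : star (y (x : UGroup E)) * y (x : UGroup E) = 1 := Unitary.coe_star_mul_self (Y x)
  have hu2 : y (x : UGroup E) * star (y (x : UGroup E)) = 1 := Unitary.coe_mul_star_self (Y x)
  have hcomm : p * star (y (x : UGroup E)) = star (y (x : UGroup E)) * p := by
    calc p * star (y (x : UGroup E)) = star (y (x : UGroup E)) * (p * p) * p *
          star (y (x : UGroup E)) := by rw [h1, hu1, one_mul]
      _ = star (y (x : UGroup E)) * p * ((p * p) * star (y (x : UGroup E))) := by noncomm_ring
      _ = star (y (x : UGroup E)) * p := by rw [h1, hu2, mul_one]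
  -- Both sides are near `1` and square to the inverse of `y`, so they agree; this makes the root
  -- `p` unitary.
  have hp : star p = p * star (y (x : UGroup E)) := by
    refine hNinj _ h2 _ h4 ?_
    calc star p * star p = star (p * p) := (star_mul _ _).symm
      _ = star (y (x : UGroup E)) * (p * p) * star (y (x : UGroup E)) := by
          rw [h1, hu1, one_mul]
      _ = star (y (x : UGroup E)) * p * (p * star (y (x : UGroup E))) := by noncomm_ring
      _ = _ := by rw [← hcomm]
  -- Likewise both sides square to the inverse of `y`. With `τ(p) = p⁻¹`, the Cartan map at `u p` is
  -- `u p² τ(u)⁻¹ = x`.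
  have hτp : tauLinear α p = star p := by
    refine hNinj _ h3 _ h2 ?_
    change tauLinear α p * tauLinear α p = star p * star p
    rw [← tauLinear_mul, h1, ← star_mul, h1]
    exact congrArg Subtype.val hτY
  let P : UGroup E := ⟨p, by
    rw [Unitary.mem_iff]
    constructor
    · rw [hp, hcomm, mul_assoc, h1, hu1]
    · rw [hp, ← mul_assoc, h1, hu2]⟩
  have hPP : P * P = Y x := Subtype.ext h1
  have hτP : tau α P = P⁻¹ := Subtype.ext hτp
  refine ⟨u * P, rfl, Subtype.ext ?_⟩
  change u * P * tau α (u * P)⁻¹ = x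
  rw [mul_inv_rev, map_mul, map_inv, hτP, inv_inv, mul_assoc, ← mul_assoc P, hPP]
  simp only [Y, map_inv]
  group

theorem isCartanEmbedding {ε : ℤˣ} (hα : ∀ v, α (α v) = ε • v) :
    IsCartanEmbedding (tau α) := by
  have hτ := tau_tau hα
  let f : (UGroup E ⧸ fixedSubgroup (tau α)) → cartanSet (tau α) :=
    Quotient.lift (cartanMap hτ) fun u w h =>
      (cartanMap_eq_iff hτ u w).2 (QuotientGroup.leftRel_apply.1 h)
  have hf : Function.Bijective f := by
    refine ⟨?_, fun x => ?_⟩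
    · intro a b
      induction a using QuotientGroup.induction_on
      induction b using QuotientGroup.induction_on
      exact fun h => QuotientGroup.eq.2 ((cartanMap_eq_iff hτ _ _).1 h)
    · obtain ⟨u, hu⟩ := surjective_cartanMap hα x
      exact ⟨(u : UGroup E ⧸ fixedSubgroup (tau α)), hu⟩
  have hc : Continuous f := continuous_quot_lift _ (continuous_cartanMap hτ)
  let F := hc.homeoOfEquivCompactToT2 (f := Equiv.ofBijective f hf)
  have hF : ∀ u : UGroup E, F (u : UGroup E ⧸ fixedSubgroup (tau α)) = cartanMap hτ u :=
    fun u => rfl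
  refine ⟨F, fun u => rfl, fun φ u => ?_⟩
  simp only [hF]
  constructor
  · rintro ⟨g, hg, hφ⟩
    -- On unitaries the inverse is the adjoint, so this formula extends the Cartan map
    -- real-analytically to all endomorphisms.
    refine ⟨fun a => g (a * tauLinear α (star a)), ?_, ?_⟩
    · refine AnalyticAt.comp (g := g) hg ?_
      exact analyticAt_id.mul (((tauLinear α).analyticAt _).comp (analyticAt_star _))
    · exact ((continuous_cartanMap hτ).tendsto u).eventually hφ
  · rintro ⟨g, hg, hφ⟩
    obtain ⟨s, hsa, hsu, hs⟩ := exists_analytic_section hτ u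
    -- Composing with the local section `s` descends analyticity from the group to the image.
    refine ⟨fun a => g (s a), ?_, ?_⟩
    · refine AnalyticAt.comp (g := g) ?_ hsa
      rwa [hsu]
    · rw [nhds_subtype_eq_comap, Filter.eventually_comap] at hφ
      have hlim : Filter.Tendsto (fun x : cartanSet (tau α) => s (x : UGroup E))
          (nhds (cartanMap hτ u)) (nhds u) := by
        have h := hsa.continuousAt.tendsto
        rw [hsu] at h
        exact h.comp ((continuous_subtype_val.comp continuous_subtype_val).tendsto _)
      filter_upwards [hs, hlim.eventually hφ] with x ⟨w, hw, hwx⟩ h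
      have h1 := h w hw
      rw [hwx] at h1
      change φ x = g (s (x : UGroup E))
      rw [← hw]
      exact h1

end CartanEmbedding

/-! ### The threefold way -/

theorem mainTheorem2 {G : Type*} [Group G] {V : Type*} [NormedAddCommGroup V]
    [InnerProductSpace ℂ V] [FiniteDimensional ℂ V] (S : SymmetryAction G V) :
    -- sector systems exist
    (∃ (m : ℕ) (R : Fin m → Submodule ℂ V), Nonempty (SectorSystem S (Fin m) (fun l => R l))) ∧
    ∀ {Λ : Type*} {R : Λ → Type*} [∀ l, NormedAddCommGroup (R l)]
      [∀ l, InnerProductSpace ℂ (R l)] (𝓡 : SectorSystem S Λ R),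
      -- `V` is the orthogonal sum of finitely many sectors
      (Finite Λ ∧ (⨆ l, 𝓡.sector l) = ⊤ ∧ Pairwise fun l m => 𝓡.sector l ⟂ 𝓡.sector m) ∧
      -- the Hermitian structure of the multiplicity spaces
      (∀ (l : Λ) (ψ ψ' : 𝓡.E l) (r : R l), r ≠ 0 →
        ⟪ψ, ψ'⟫_ℂ = ⟪ψ r, ψ' r⟫_ℂ / ⟪r, r⟫_ℂ) ∧
      -- the `G₀`-compatible time evolutions
      (∃ Φ : S.unitaryCentralizer ≃ₜ* (∀ l, UGroup (𝓡.E l)),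
        ∀ (U : S.unitaryCentralizer) (l : Λ), 𝓡.ActsAs (U : UGroup V) (Φ U l)) ∧
      (∀ l : Λ, ∃ c : UGroup (𝓡.E l) ≃ₜ*
        Matrix.unitaryGroup (Fin (Module.finrank ℂ (𝓡.E l))) ℂ, IsMatrixIso c) ∧
      -- no antiunitary symmetries: every sector is in Class A
      (S.G₀ = ⊤ → 𝓡.IsProductOfFactors Set.univ ∧ ∀ l : Λ, 𝓡.factor l = Set.univ) ∧
      -- antiunitary symmetries `T G₀`
      (∀ T ∉ S.G₀, ∃ π : Equiv.Perm Λ,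
        (∀ l, S.ρ T '' (𝓡.sector l : Set V) = 𝓡.sector (π l)) ∧
        (∀ l, π (π l) = l) ∧
        -- product over the sectors, with one factor for each pair of exchanged sectors
        (∀ Ω : Set Λ, (∀ l, l ∈ Ω ∨ π l ∈ Ω) → (∀ l ∈ Ω, π l ∈ Ω → π l = l) →
          𝓡.IsProductOfFactors Ω) ∧
        -- Class A
        (∀ l, π l ≠ l → 𝓡.factor l = Set.univ) ∧
        -- Classes AI and AII
        (∀ l, π l = l →
          (∃ (α : 𝓡.E l ≃ₗᵢ⋆[ℂ] 𝓡.E l) (β : R l ≃ₗᵢ⋆[ℂ] R l), 𝓡.IsTransfer T α β) ∧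
          ∀ (α : 𝓡.E l ≃ₗᵢ⋆[ℂ] 𝓡.E l) (β : R l ≃ₗᵢ⋆[ℂ] R l), 𝓡.IsTransfer T α β →
            𝓡.factor l = cartanSet (tau α) ∧
            IsCartanEmbedding (tau α) ∧
            ∃ εα : ℤˣ, (∀ ψ, α (α ψ) = εα • ψ) ∧
              (∀ z : ℂ, (∀ v, S.ρ T (S.ρ T v) = z • v) →
                ∃ εT εβ : ℤˣ, (∀ v, S.ρ T (S.ρ T v) = εT • v) ∧
                  (∀ r, β (β r) = εβ • r) ∧ εα = εT * εβ) ∧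
              (εα = 1 → IsCosetModel (fixedSubgroup (tau α))
                (orthogonalSubgroup (Fin (Module.finrank ℂ (𝓡.E l))))) ∧
              (εα = -1 → ∃ n : ℕ, Module.finrank ℂ (𝓡.E l) = 2 * n ∧
                IsCosetModel (fixedSubgroup (tau α)) (unitarySymplecticSubgroup (Fin n))))) := by
  refine ⟨S.exists_sectorSystem, fun {Λ R} _ _ 𝓡 => ⟨⟨𝓡.finite, 𝓡.iSup_sector,
    𝓡.pairwise_orthogonal⟩, fun l ψ ψ' r hr => ?_, 𝓡.exists_continuousMulEquiv,
    fun l => exists_isMatrixIso, fun h => ⟨𝓡.isProductOfFactors_of_eq_top h,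
    𝓡.factor_eq_univ_of_eq_top h⟩, fun T hT => ?_⟩⟩
  · rw [𝓡.inner_apply_apply, mul_div_cancel_right₀ _ (inner_self_ne_zero.2 hr)]
  obtain ⟨π, him, hinv⟩ := 𝓡.exists_perm hT
  refine ⟨π, him, hinv, fun Ω h₁ h₂ => 𝓡.isProductOfFactors_of_notMem him hinv hT h₁ h₂,
    fun l hl => 𝓡.factor_eq_univ_of_ne him hinv hT hl, fun l hl =>
    ⟨𝓡.exists_isTransfer hT ((him l).trans (by rw [hl])), fun α β h => ?_⟩⟩
  obtain ⟨εα, hα⟩ := 𝓡.exists_smul_of_isTransfer hT h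
  refine ⟨𝓡.factor_eq_cartanSet him hinv hT hl h, isCartanEmbedding hα, εα, hα,
    fun z hz => 𝓡.exists_signs_of_isTransfer hT h hα hz, fun h1 => ?_, fun h1 => ?_⟩
  · exact isCosetModel_orthogonal α fun v => by rw [hα, h1, one_smul]
  · obtain ⟨n, b, hn, hl, hr⟩ := exists_orthonormalBasis_quaternionic α fun v => by
      rw [hα, h1, Units.neg_smul, one_smul]
    exact ⟨n, hn, isCosetModel_symplectic α b hl hr⟩
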